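/- Let $F$ be the free group on a finite set $X=\{x_1,\dots,x_n\}$. Write $g^h=h^{-1}gh$, $H^g=g^{-1}Hg$ and $A^B=\{a^b : a\in A,\ b\in B\}$. For $S\subseteq F$ and $g\in F$, the order of $g$ in $S$ is the least $k\ge 1$ with $g^k\in S$, and $0$ if there is none; let $F_k(S)$ be the set of elements of $F$ of order $k$ in $S$. For $H\le F$, the Schreier automaton $\mathrm{Sch}(H)$ has the right cosets of $H$ as vertices and an arc $Hg\to Hga$ labelled $a$ for every coset $Hg$ and every letter $a\in X^{\pm1}$; a walk is reduced if it has no backtracking. The coset Stallings automaton $\mathrm{St}(Hu)$ is the full subgraph on the vertices that appear in some reduced walk from $H$ to $Hu$, and $\mathrm{St}(H)$ is the case $u=1$. The restricted Stallings automaton $\mathrm{St}^*(H)$ is obtained from $\mathrm{St}(H)$ by removing all hanging trees (a hanging tree is a tree glued to the rest of the graph at one vertex, and that vertex is kept). A trail of length $k\ge1$ is a sequence of vertices $q=(q_0,\dots,q_k)$ that are either pairwise different, or such that $q_0,\dots,q_{k-1}$ are pairwise different and $q_k=q_0$ (a closed trail). Its preorbit $F_q(H)$ is the set of $w\in F$ that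 label a walk in $\mathrm{Sch}(H)$ from $q_{i-1}$ to $q_i$ for every $i=1,\dots,k$. 1. There is an algorithm that, given a finite list of words generating a subgroup $H\le F$, a word $u$ and an integer $k\ge1$, decides whether $F_k(Hu)\neq\varnothing$ and, if so, computes finitely many elements $w_1,\dots,w_t\in F$, each of order $k$ in $Hu$, and a free basis of $H\cap H^u$, such that $$F_k(Hu)=\Big(\bigsqcup_{i=1}^{t}\big(H\cap H^{w_i}\cap H^{w_i^2}\cap\cdots\cap H^{w_i^{k-1}}\big)w_i\Big)^{H\cap H^u},$$ where the $t$ cosets inside the brackets are pairwise disjoint. In particular, the set $F_k(Hu)$ is computable, uniformly in $H$, $u$ and $k\ge 1$. 2. Let $H\le F$ be finitely generated, $u\in F$ and $k\ge1$. There are finitely many trails $q$ of length $k$ in $\mathrm{St}(Hu)$, and, whenever $v_q$ labels a walk from $q_0$ to $H$ and $v'_q$ labels a walk from $q_k$ to $Hu$ for every such $q$, $$F_k(Hu)=\bigcup_{q}\big(F_q(H)\big)^{v_qH\,\cap\,v'_qH^u},$$ where $q$ runs over these trails, and any two terms of the union are equal or disjoint. 3. Let $H\le F$ be finitely generated and $k\ge1$.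 There are finitely many closed trails $q$ of length $k$ in $\mathrm{St}^*(H)$, and, whenever $v_q$ labels a walk from $q_0$ to $H$ for every such $q$, $$F_k(H)=\Big(\bigcup_{q}\big(F_q(H)\big)^{v_q}\Big)^{H},$$ where $q$ runs over these closed trails, and any two of the sets $(F_q(H))^{v_q}$ are equal or disjoint. -/

import Mathlib

/-! ### Relative orders and conjugation in a group -/

section Groups

variable {G : Type*} [Group G]

/-- The relative order of `g` in `S`: the least `k ≥ 1` with `g ^ k ∈ S`, and `0` if there is none
(the infimum of the empty set of natural numbers is `0`). -/
noncomputable def relOrder (S : Set G) (g : G) : ℕ :=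
  sInf {k : ℕ | 1 ≤ k ∧ g ^ k ∈ S}

/-- The set of elements of `G` of order `k` in `S`. -/
def preorderSet (S : Set G) (k : ℕ) : Set G :=
  {g : G | relOrder S g = k}

/-- The right coset `K w`. -/
def rCoset (K : Subgroup G) (w : G) : Set G :=
  {x : G | ∃ h ∈ K, x = h * w}

/-- The left coset `w K`. -/
def lCoset (w : G) (K : Subgroup G) : Set G :=
  {x : G | ∃ h ∈ K, x = w * h}

/-- The conjugate subgroup `H ^ g = g⁻¹ H g`. -/
def conjSubgroup (H : Subgroup G) (g : G) : Subgroup G :=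
  H.map (MulAut.conj g⁻¹).toMonoidHom

/-- The set `A ^ B` of all conjugates `a ^ b = b⁻¹ a b` with `a ∈ A` and `b ∈ B`. -/
def conjSet (A B : Set G) : Set G :=
  {x : G | ∃ a ∈ A, ∃ b ∈ B, x = b⁻¹ * a * b}

/-- The coset `(H ∩ H ^ w ∩ H ^ (w ^ 2) ∩ ⋯ ∩ H ^ (w ^ (k - 1))) w`. -/
def orbitCoset (H : Subgroup G) (k : ℕ) (w : G) : Set G :=
  rCoset (⨅ j : Fin k, conjSubgroup H (w ^ (j : ℕ))) w

/-- The family `b` of elements of `G` is a free basis of the subgroup `K`. -/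
def IsFreeBasisOf {ι : Type*} (b : ι → G) (K : Subgroup G) : Prop :=
  ∃ B : FreeGroupBasis ι K, ∀ i, ((B i : K) : G) = b i

end Groups

/-! ### Involutive automata -/

/-- The letters of the involutive closure of the alphabet `X`: `(x, true)` is `x` and `(x, false)`
is the formal inverse of `x`. -/
abbrev Letter (X : Type*) := X × Bool

/-- An involutive labelled digraph, with vertices in `V` and labels in the involutive closure of
`X`. There is at most one arc with a given origin, label and end (which is no restriction for
deterministic automata), and arcs come in mutually inverse pairs. -/
structure InvDigraph (X V : Type*) where
  verts : Set V
  arc : V → Letter X → V → Prop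
  arc_left : ∀ {p a q}, arc p a q → p ∈ verts
  arc_inv : ∀ {p x b q}, arc p (x, b) q → arc q (x, !b) p

namespace InvDigraph

variable {X V : Type*}

/-- There is a walk from `p` to `q` with the given label. -/
def IsWalk (Γ : InvDigraph X V) : V → List (Letter X) → V → Prop
  | p, [], q => p ∈ Γ.verts ∧ p = q
  | p, a :: L, q => ∃ r, Γ.arc p a r ∧ Γ.IsWalk r L q

/-- The element `w` of the free group labels a walk from `p` to `q`. -/
def Reads (Γ : InvDigraph X V) (p : V) (w : FreeGroup X) (q : V) : Prop :=
  ∃ L : List (Letter X), FreeGroup.mk L = w ∧ Γ.IsWalk p L q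

/-- The full subgraph on a set of vertices. -/
def induce (Γ : InvDigraph X V) (S : Set V) : InvDigraph X V where
  verts := Γ.verts ∩ S
  arc p a q := Γ.arc p a q ∧ p ∈ S ∧ q ∈ S
  arc_left h := ⟨Γ.arc_left h.1, h.2.1⟩
  arc_inv h := ⟨Γ.arc_inv h.1, h.2.2, h.2.1⟩

/-- The core of a deterministic involutive automaton with initial vertex `p` and terminal vertex
`q`: the full subgraph on the vertices that appear in some reduced walk from `p` to `q`. (In a
deterministic involutive digraph a walk has no backtracking exactly if its label is reduced.) -/
def core (Γ : InvDigraph X V) (p q : V) : InvDigraph X V :=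
  Γ.induce {x | ∃ L₁ L₂ : List (Letter X),
    FreeGroup.IsReduced (L₁ ++ L₂) ∧ Γ.IsWalk p L₁ x ∧ Γ.IsWalk x L₂ q}

/-- A (deterministic, involutive) digraph is a tree if it is nonempty and any two vertices are
joined by exactly one reduced walk. -/
def IsTree (Γ : InvDigraph X V) : Prop :=
  Γ.verts.Nonempty ∧ ∀ p ∈ Γ.verts, ∀ q ∈ Γ.verts,
    ∃! L : List (Letter X), FreeGroup.IsReduced L ∧ Γ.IsWalk p L q

/-- The subgraph on the vertex set `T` whose arcs are the arcs of `Γ` between vertices of `T`,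
except for the loops at `a`. -/
def branch (Γ : InvDigraph X V) (T : Set V) (a : V) : InvDigraph X V where
  verts := Γ.verts ∩ T
  arc p l q := Γ.arc p l q ∧ p ∈ T ∧ q ∈ T ∧ (p ≠ a ∨ q ≠ a)
  arc_left h := ⟨Γ.arc_left h.1, h.2.1⟩
  arc_inv h := ⟨Γ.arc_inv h.1, h.2.2.1, h.2.1, h.2.2.2.symm⟩

/-- `T` is the vertex set of a hanging tree of `Γ`, glued to the rest of `Γ` at the vertex `a`. -/
def IsHangingTree (Γ : InvDigraph X V) (T : Set V) (a : V) : Prop :=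
  T ⊆ Γ.verts ∧ a ∈ T ∧ (Γ.branch T a).IsTree ∧
    ∀ p ∈ T, p ≠ a → ∀ l q, Γ.arc p l q → q ∈ T

/-- The restricted core: all hanging trees are removed (the vertex at which a hanging tree is glued
is not removed with that tree). -/
def restrictedCore (Γ : InvDigraph X V) : InvDigraph X V :=
  Γ.induce {x | ¬ ∃ T a, Γ.IsHangingTree T a ∧ x ∈ T ∧ x ≠ a}

/-- An open trail of length `k`: a sequence `(q₀, …, q_k)` of pairwise different vertices. -/
def IsOpenTrail (Γ : InvDigraph X V) {k : ℕ} (q : Fin (k + 1) → V) : Prop :=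
  (∀ i, q i ∈ Γ.verts) ∧ Function.Injective q

/-- A closed trail of length `k ≥ 1`: a sequence `(q₀, …, q_{k-1}, q_k = q₀)` of vertices with
`q₀, …, q_{k-1}` pairwise different. -/
def IsClosedTrail (Γ : InvDigraph X V) {k : ℕ} (q : Fin (k + 1) → V) : Prop :=
  0 < k ∧ (∀ i, q i ∈ Γ.verts) ∧ Function.Injective (fun i : Fin k => q i.castSucc) ∧
    q (Fin.last k) = q 0

/-- A trail is an open or a closed trail. -/
def IsTrail (Γ : InvDigraph X V) {k : ℕ} (q : Fin (k + 1) → V) : Prop :=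
  Γ.IsOpenTrail q ∨ Γ.IsClosedTrail q

/-- The preorbit of a finite trail: the elements that can be read between any two successive
vertices. -/
def preorbit (Γ : InvDigraph X V) {k : ℕ} (q : Fin (k + 1) → V) : Set (FreeGroup X) :=
  {w | ∀ i : Fin k, Γ.Reads (q i.castSucc) w (q i.succ)}

end InvDigraph

/-! ### Schreier and Stallings automata of subgroups of a free group -/

section Stallings

variable {X : Type*}

/-- The set `H \ F` of right cosets of `H`. -/
abbrev RightCosets (H : Subgroup (FreeGroup X)) := Quotient (QuotientGroup.rightRel H)

/-- The right coset `H g`, as a vertex of the Schreier automaton. -/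
def cosetVertex (H : Subgroup (FreeGroup X)) (g : FreeGroup X) : RightCosets H :=
  Quotient.mk (QuotientGroup.rightRel H) g

/-- The underlying digraph of the Schreier automaton of `H`: arcs `H g → H g a` with label `a`. -/
def schreier (H : Subgroup (FreeGroup X)) : InvDigraph X (RightCosets H) where
  verts := Set.univ
  arc p a q := ∃ g, p = cosetVertex H g ∧ q = cosetVertex H (g * FreeGroup.mk [a])
  arc_left _ := Set.mem_univ _
  arc_inv := by
    rintro p x b q ⟨g, rfl, rfl⟩
    refine ⟨g * FreeGroup.mk [(x, b)], rfl, ?_⟩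
    have h : FreeGroup.mk [(x, b)] * FreeGroup.mk [(x, !b)] = 1 := by
      have : FreeGroup.mk [(x, !b)] = (FreeGroup.mk [(x, b)])⁻¹ := by
        simp [FreeGroup.inv_mk, FreeGroup.invRev]
      rw [this, mul_inv_cancel]
    rw [mul_assoc, h, mul_one]

/-- The coset Stallings automaton of `H u`: the core of the Schreier automaton of `H` with initial
vertex `H` and terminal vertex `H u`. -/
def cosetStallings (H : Subgroup (FreeGroup X)) (u : FreeGroup X) :
    InvDigraph X (RightCosets H) :=
  (schreier H).core (cosetVertex H 1) (cosetVertex H u)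

/-- The restricted Stallings automaton of `H`: the restricted core of the Stallings automaton. -/
def restrictedStallings (H : Subgroup (FreeGroup X)) : InvDigraph X (RightCosets H) :=
  (cosetStallings H 1).restrictedCore

/-- The subgroup of the free group generated by a finite list of words. -/
def spanWords (S : List (List (Letter X))) : Subgroup (FreeGroup X) :=
  Subgroup.closure {g | ∃ L ∈ S, g = FreeGroup.mk L}

end Stallings

/-! `F` acts on the right cosets of `H` by right translation, and `w` labels a walk from `p` to `q`
in the Schreier automaton exactly when it moves `p` to `q` (`schreier_reads_iff`). For `k ≥ 1`, an
element `z` has order `k` in `Hu` exactly when the sequence `H, Hz, …, Hz^k` ends in `Hu` and has no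
coincidence, except possibly between its two ends (`mem_preorderSet_rCoset_iff`). So the order
depends on this sequence only, and translating the sequence by `c` corresponds to conjugating `z` by
`c`.

Trails: write `z = C D C⁻¹` with `D` cyclically reduced. Then `z^i C = C D^i` is read along the
reduced word of `z^k`, so the sequence translated by `C` is a trail in `St(Hu)`. The conjugators
that recover `z` are the elements carrying the ends of the trail back to `H` and `Hu`. For `u = 1`
and `z ≠ 1`, every vertex of the translated trail lies on a closed walk with the cyclically reduced
label `D^k`, and such a vertex survives the removal of hanging trees (`not_mem_hangingTree`).

Algorithm: a reduced walk between vertices traced by the generators and `u` stays among these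
finitely many vertices (`staysIn_toWord`). The pigeonhole principle on tuples of vertices therefore
shortens a word without changing its effect on a given tuple (`exists_short_of_staysIn`).
Consequently every element of order `k` is, up to conjugation by `H ∩ H^u`, in the orbit coset of a
word of bounded length (`exists_short_orbit_rep`). An orbit coset is a class of the relation `H v^j
= H w^j` for all `j ≤ k`, so a greedy selection among short words gives disjoint cosets. Membership
in `H` is decided as in Marshall Hall's theorem: a word outside `H` is separated from `H` by
permutations of a set of computable size (`memSpan_iff`).

Free basis: `H ∩ H^u` is the stabilizer of the pair `(H, Hu)`. A greedy, prefix-closed list of short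
coset representatives is a tree meeting every coset visited by a reduced word of this subgroup, and
the chords of the tree give a free basis (`isFreeBasisOf_chordWord`). All of these searches are
bounded, hence primitive recursive. -/

/-! ### The right action on the cosets -/

section Move

variable {X : Type*} {H : Subgroup (FreeGroup X)}

/-- The right translate of a coset. -/
def move (p : RightCosets H) (w : FreeGroup X) : RightCosets H :=
  Quotient.map' (s₁ := QuotientGroup.rightRel H) (s₂ := QuotientGroup.rightRel H) (· * w)
    (fun a b h => by
      rw [QuotientGroup.rightRel_apply] at h ⊢
      simpa [mul_assoc] using h) p

@[simp] theorem move_cosetVertex (g w : FreeGroup X) :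
    move (cosetVertex H g) w = cosetVertex H (g * w) := rfl

theorem cosetVertex_eq_iff {g g' : FreeGroup X} :
    cosetVertex H g = cosetVertex H g' ↔ g' * g⁻¹ ∈ H := by
  unfold cosetVertex
  rw [Quotient.eq, QuotientGroup.rightRel_apply]

theorem exists_cosetVertex (p : RightCosets H) : ∃ g, p = cosetVertex H g := by
  induction p using Quotient.inductionOn with
  | h g => exact ⟨g, rfl⟩

@[simp] theorem move_one (p : RightCosets H) : move p 1 = p := by
  obtain ⟨g, rfl⟩ := exists_cosetVertex p
  simp

theorem move_mul (p : RightCosets H) (w w' : FreeGroup X) :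
    move p (w * w') = move (move p w) w' := by
  obtain ⟨g, rfl⟩ := exists_cosetVertex p
  simp [mul_assoc]

theorem move_eq_iff {p q : RightCosets H} {w : FreeGroup X} :
    move p w = q ↔ p = move q w⁻¹ := by
  constructor
  · rintro rfl; simp [← move_mul]
  · rintro rfl; simp [← move_mul]

theorem move_injective (w : FreeGroup X) :
    Function.Injective (fun p : RightCosets H => move p w) := by
  intro p q h
  have h' : move p w = move q w := h
  rw [move_eq_iff] at h'
  simpa [← move_mul] using h'

theorem mem_rCoset_iff {u x : FreeGroup X} :
    x ∈ rCoset H u ↔ cosetVertex H x = cosetVertex H u := by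
  rw [eq_comm, cosetVertex_eq_iff]
  constructor
  · rintro ⟨h, hh, rfl⟩; simpa using hh
  · intro h; exact ⟨_, h, by simp⟩

theorem cosetVertex_eq_base_iff {x : FreeGroup X} :
    cosetVertex H x = cosetVertex H 1 ↔ x ∈ H := by
  rw [eq_comm, cosetVertex_eq_iff]; simp

theorem mem_conjSubgroup_iff {u x : FreeGroup X} :
    x ∈ conjSubgroup H u ↔ u * x * u⁻¹ ∈ H := by
  unfold conjSubgroup
  rw [Subgroup.mem_map]
  constructor
  · rintro ⟨h, hh, rfl⟩
    simpa [MulAut.conj_apply, mul_assoc] using hh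
  · intro h
    exact ⟨_, h, by simp [mul_assoc]⟩

theorem mem_conjSubgroup_iff_move {u x : FreeGroup X} :
    x ∈ conjSubgroup H u ↔ move (cosetVertex H u) x = cosetVertex H u := by
  rw [mem_conjSubgroup_iff, move_cosetVertex, eq_comm, cosetVertex_eq_iff]

theorem mem_iff_move {x : FreeGroup X} :
    x ∈ H ↔ move (cosetVertex H 1) x = cosetVertex H 1 := by
  rw [move_cosetVertex, one_mul, cosetVertex_eq_base_iff]

theorem schreier_arc_iff {p q : RightCosets H} {a : Letter X} :
    (schreier H).arc p a q ↔ move p (FreeGroup.mk [a]) = q := by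
  constructor
  · rintro ⟨g, rfl, rfl⟩; rfl
  · rintro rfl
    obtain ⟨g, rfl⟩ := exists_cosetVertex p
    exact ⟨g, rfl, rfl⟩

theorem mk_cons (a : Letter X) (L : List (Letter X)) :
    FreeGroup.mk (a :: L) = FreeGroup.mk [a] * FreeGroup.mk L := by
  rw [FreeGroup.mul_mk]; rfl

theorem schreier_isWalk_iff {p q : RightCosets H} {L : List (Letter X)} :
    (schreier H).IsWalk p L q ↔ move p (FreeGroup.mk L) = q := by
  induction L generalizing p with
  | nil =>
    rw [← FreeGroup.one_eq_mk, move_one]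
    simp [InvDigraph.IsWalk, schreier]
  | cons a L ih =>
    rw [mk_cons, move_mul]
    simp [InvDigraph.IsWalk, schreier_arc_iff, ih]

/-- The action is by group elements, so the choice of a word for `w` is immaterial. From here on
walks in the Schreier automaton are replaced by equations between cosets. -/
theorem schreier_reads_iff {p q : RightCosets H} {w : FreeGroup X} :
    (schreier H).Reads p w q ↔ move p w = q := by
  unfold InvDigraph.Reads
  simp only [schreier_isWalk_iff]
  constructor
  · rintro ⟨L, rfl, h⟩; exact h
  · intro h
    obtain ⟨L, rfl⟩ := Quot.exists_rep w
    exact ⟨L, rfl, h⟩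

theorem mem_preorbit_iff {k : ℕ} {q : Fin (k + 1) → RightCosets H} {w : FreeGroup X} :
    w ∈ (schreier H).preorbit q ↔ ∀ i : Fin k, move (q i.castSucc) w = q i.succ := by
  simp [InvDigraph.preorbit, schreier_reads_iff]

/-- All vertices visited when `L` is read from `p` belong to `V`. -/
def StaysIn (V : Set (RightCosets H)) (p : RightCosets H) (L : List (Letter X)) : Prop :=
  ∀ M, M <+: L → move p (FreeGroup.mk M) ∈ V

variable {V : Set (RightCosets H)} {p : RightCosets H} {L M : List (Letter X)}

theorem StaysIn.start (h : StaysIn V p L) : p ∈ V := by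
  simpa [← FreeGroup.one_eq_mk] using h [] (List.nil_prefix)

theorem StaysIn.of_prefix (h : StaysIn V p L) (hM : M <+: L) : StaysIn V p M :=
  fun N hN => h N (hN.trans hM)

theorem StaysIn.append (h : StaysIn V p L) (h' : StaysIn V (move p (FreeGroup.mk L)) M) :
    StaysIn V p (L ++ M) := by
  rintro N ⟨R, hR⟩
  rcases List.append_eq_append_iff.mp hR with ⟨A, rfl, -⟩ | ⟨A, rfl, rfl⟩
  · exact h N (List.prefix_append _ _)
  · rw [← FreeGroup.mul_mk, move_mul]; exact h' A (List.prefix_append _ _)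

theorem StaysIn.of_append (h : StaysIn V p (L ++ M)) :
    StaysIn V (move p (FreeGroup.mk L)) M := by
  intro N hN
  rw [← move_mul, FreeGroup.mul_mk]
  exact h _ ((List.prefix_append_right_inj L).mpr hN)

theorem StaysIn.invRev (h : StaysIn V p L) :
    StaysIn V (move p (FreeGroup.mk L)) (FreeGroup.invRev L) := by
  rintro N ⟨R, hR⟩
  have hL : L = FreeGroup.invRev R ++ FreeGroup.invRev N := by
    rw [← FreeGroup.invRev_append, hR, FreeGroup.invRev_invRev]
  rw [← move_mul]
  have : FreeGroup.mk L * FreeGroup.mk N = FreeGroup.mk (FreeGroup.invRev R) := by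
    rw [hL, ← FreeGroup.mul_mk, ← FreeGroup.inv_mk (L := N), inv_mul_cancel_right]
  rw [this]
  exact h _ ⟨_, hL.symm⟩

/-- Cancelling a pair of inverse letters deletes an excursion along an arc and back, so no new
vertex is visited. -/
theorem StaysIn.step (h : StaysIn V p L) (hs : FreeGroup.Red.Step L M) : StaysIn V p M := by
  cases hs with
  | @not L₁ L₂ x b =>
    have h₁ : StaysIn V p L₁ := h.of_prefix (List.prefix_append _ _)
    have h₂ : StaysIn V p (L₁ ++ [(x, b), (x, !b)]) := h.of_prefix ⟨L₂, by simp⟩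
    have h₃ := StaysIn.of_append (L := L₁ ++ [(x, b), (x, !b)]) (M := L₂) (by simpa using h)
    refine h₁.append ?_
    have : FreeGroup.mk (L₁ ++ [(x, b), (x, !b)]) = FreeGroup.mk L₁ := by
      apply Quot.sound
      simpa using FreeGroup.Red.Step.not (L₁ := L₁) (L₂ := []) (x := x) (b := b)
    rwa [this] at h₃

theorem StaysIn.red (h : StaysIn V p L) (hs : FreeGroup.Red L M) : StaysIn V p M := by
  induction hs with
  | refl => exact h
  | tail _ hs ih => exact ih.step hs

end Move

/-! ### The vertices traced by the generators -/

section Trace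

variable {X : Type*}

/-- The prefixes of `u` and of the words of `S`. -/
def prefixList (S : List (List (Letter X))) (u : List (Letter X)) : List (List (Letter X)) :=
  (u :: S).flatMap List.inits

/-- The vertices traced by `u` and by the words of `S`. -/
def tracedVerts (S : List (List (Letter X))) (u : List (Letter X)) :
    Set (RightCosets (spanWords S)) :=
  {v | ∃ p ∈ prefixList S u, v = cosetVertex (spanWords S) (FreeGroup.mk p)}

variable {S : List (List (Letter X))} {u : List (Letter X)}

theorem mem_prefixList {p : List (Letter X)} :
    p ∈ prefixList S u ↔ ∃ L ∈ u :: S, p <+: L := by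
  unfold prefixList
  rw [List.mem_flatMap]
  simp only [List.mem_inits]

theorem tracedVerts_eq_image : tracedVerts S u =
    (fun p => cosetVertex (spanWords S) (FreeGroup.mk p)) '' {p | p ∈ prefixList S u} := by
  ext v; simp [tracedVerts, eq_comm]

theorem finite_tracedVerts : (tracedVerts S u).Finite := by
  rw [tracedVerts_eq_image]
  exact (List.finite_toSet _).image _

theorem ncard_tracedVerts_le : (tracedVerts S u).ncard ≤ (prefixList S u).length := by
  classical
  have h : tracedVerts S u = ((prefixList S u).toFinset.image
      (fun p => cosetVertex (spanWords S) (FreeGroup.mk p)) : Set _) := by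
    rw [tracedVerts_eq_image]; ext; simp
  rw [h, Set.ncard_coe_finset]
  exact Finset.card_image_le.trans (List.toFinset_card_le _)

theorem staysIn_of_mem_prefixList {p : List (Letter X)} (hp : p ∈ prefixList S u) :
    StaysIn (tracedVerts S u) (cosetVertex (spanWords S) 1) p := by
  intro M hM
  obtain ⟨L, hL, hpL⟩ := mem_prefixList.mp hp
  exact ⟨M, mem_prefixList.mpr ⟨L, hL, hM.trans hpL⟩, by simp⟩

theorem nil_mem_prefixList : ([] : List (Letter X)) ∈ prefixList S u :=
  mem_prefixList.mpr ⟨u, by simp, List.nil_prefix⟩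

theorem base_mem_tracedVerts : cosetVertex (spanWords S) 1 ∈ tracedVerts S u :=
  ⟨[], nil_mem_prefixList, by rw [← FreeGroup.one_eq_mk]⟩

theorem target_mem_tracedVerts :
    cosetVertex (spanWords S) (FreeGroup.mk u) ∈ tracedVerts S u :=
  ⟨u, mem_prefixList.mpr ⟨u, by simp, List.prefix_rfl⟩, rfl⟩

theorem mk_mem_spanWords {L : List (Letter X)} (hL : L ∈ S) : FreeGroup.mk L ∈ spanWords S :=
  Subgroup.subset_closure ⟨L, hL, rfl⟩

/-- Each generator labels a closed walk at the base vertex through traced vertices, and such closed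
walks can be concatenated and reversed. -/
theorem exists_staysIn_of_mem {h : FreeGroup X} (hh : h ∈ spanWords S) :
    ∃ L, FreeGroup.mk L = h ∧
      StaysIn (tracedVerts S u) (cosetVertex (spanWords S) 1) L := by
  have key : ∀ {g : FreeGroup X}, g ∈ spanWords S →
      move (cosetVertex (spanWords S) 1) g = cosetVertex (spanWords S) 1 :=
    fun hg => mem_iff_move.mp hg
  refine Subgroup.closure_induction (p := fun h _ => ∃ L, FreeGroup.mk L = h ∧
      StaysIn (tracedVerts S u) (cosetVertex (spanWords S) 1) L) ?_ ?_ ?_ ?_ hh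
  · rintro _ ⟨L, hL, rfl⟩
    exact ⟨L, rfl, staysIn_of_mem_prefixList
      (mem_prefixList.mpr ⟨L, by simp [hL], List.prefix_rfl⟩)⟩
  · exact ⟨[], rfl, staysIn_of_mem_prefixList nil_mem_prefixList⟩
  · rintro x y hx hy ⟨L, rfl, hL⟩ ⟨M, rfl, hM⟩
    exact ⟨L ++ M, rfl, hL.append (by rw [key hx]; exact hM)⟩
  · rintro x hx ⟨L, rfl, hL⟩
    refine ⟨FreeGroup.invRev L, rfl, ?_⟩
    have := hL.invRev
    rwa [key hx] at this

/-- A reduced walk between traced vertices visits traced vertices only. -/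
theorem staysIn_toWord [DecidableEq X] {a b : RightCosets (spanWords S)} {w : FreeGroup X}
    (ha : a ∈ tracedVerts S u) (hb : b ∈ tracedVerts S u) (hw : move a w = b) :
    StaysIn (tracedVerts S u) a w.toWord := by
  obtain ⟨p, hp, rfl⟩ := ha
  obtain ⟨q, hq, rfl⟩ := hb
  have hp' := staysIn_of_mem_prefixList hp
  have hq' := staysIn_of_mem_prefixList hq
  rw [move_cosetVertex, eq_comm, cosetVertex_eq_iff] at hw
  obtain ⟨L, hL, hLs⟩ := exists_staysIn_of_mem (u := u) hw
  have hinv := hp'.invRev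
  rw [move_cosetVertex, one_mul] at hinv
  -- The detour goes back to the base vertex along `p`, around a closed walk for an element of `H`,
  -- and out along `q`. Its reduction is the reduced word of `w`.
  have hw' : w = FreeGroup.mk (FreeGroup.invRev p ++ L ++ q) := by
    rw [← FreeGroup.mul_mk, ← FreeGroup.mul_mk, ← FreeGroup.inv_mk, hL]; group
  have h₁ : move (cosetVertex (spanWords S) (FreeGroup.mk p))
      (FreeGroup.mk (FreeGroup.invRev p)) = cosetVertex (spanWords S) 1 := by
    rw [← FreeGroup.inv_mk, move_cosetVertex, mul_inv_cancel]
  have h₂ : move (cosetVertex (spanWords S) 1) (FreeGroup.mk L) = cosetVertex (spanWords S) 1 := by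
    rw [hL]; exact mem_iff_move.mp hw
  have hs := (hinv.append (by rw [h₁]; exact hLs)).append (M := q) (by
    rw [← FreeGroup.mul_mk, move_mul, h₁, h₂]; exact hq')
  rw [hw', FreeGroup.toWord_mk]
  exact hs.red FreeGroup.reduce.red

theorem exists_spanWords_eq {H : Subgroup (FreeGroup X)} (hH : H.FG) :
    ∃ S : List (List (Letter X)), H = spanWords S := by
  classical
  obtain ⟨T, rfl⟩ := hH
  refine ⟨T.toList.map FreeGroup.toWord, ?_⟩
  unfold spanWords
  congr 1
  ext g
  constructor
  · intro hg
    exact ⟨g.toWord, List.mem_map.mpr ⟨g, by simpa using hg, rfl⟩, FreeGroup.mk_toWord.symm⟩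
  · rintro ⟨L, hL, rfl⟩
    obtain ⟨x, hx, rfl⟩ := List.mem_map.mp hL
    rw [FreeGroup.mk_toWord]; simpa using hx

theorem cosetStallings_verts_subset [DecidableEq X] :
    (cosetStallings (spanWords S) (FreeGroup.mk u)).verts ⊆ tracedVerts S u := by
  rintro v ⟨-, L₁, L₂, hred, h₁, h₂⟩
  rw [schreier_isWalk_iff] at h₁ h₂
  have h := staysIn_toWord (S := S) (u := u) (w := FreeGroup.mk (L₁ ++ L₂)) base_mem_tracedVerts
    target_mem_tracedVerts (by rw [← FreeGroup.mul_mk, move_mul, h₁, h₂])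
  rw [FreeGroup.toWord_mk, hred.reduce_eq] at h
  rw [← h₁]
  exact h _ (List.prefix_append _ _)

theorem finite_cosetStallings_verts {H : Subgroup (FreeGroup X)} (hH : H.FG) (u : FreeGroup X) :
    (cosetStallings H u).verts.Finite := by
  classical
  obtain ⟨S, rfl⟩ := exists_spanWords_eq hH
  rw [← FreeGroup.mk_toWord (x := u)]
  exact finite_tracedVerts.subset cosetStallings_verts_subset

end Trace

/-! ### Trails -/

section Trails

/-- The only coincidence between entries of `q` is possibly that of the first and the last one. -/
def NearlyInjective {V : Type*} {k : ℕ} (q : Fin (k + 1) → V) : Prop :=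
  ∀ i j, i < j → q i = q j → i = 0 ∧ j = Fin.last k

theorem nearlyInjective_comp_iff {V W : Type*} {k : ℕ} {q : Fin (k + 1) → V} {f : V → W}
    (hf : Function.Injective f) : NearlyInjective (fun i => f (q i)) ↔ NearlyInjective q := by
  simp [NearlyInjective, hf.eq_iff]

variable {X V : Type*} {Γ : InvDigraph X V} {k : ℕ} {q : Fin (k + 1) → V}

theorem isClosedTrail_iff (hk : 1 ≤ k) : Γ.IsClosedTrail q ↔
    (∀ i, q i ∈ Γ.verts) ∧ NearlyInjective q ∧ q (Fin.last k) = q 0 := by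
  constructor
  · rintro ⟨-, hv, hinj, hq⟩
    refine ⟨hv, ?_, hq⟩
    intro i j hij h
    obtain ⟨i, rfl⟩ := Fin.exists_castSucc_eq.mpr (ne_of_lt (lt_of_lt_of_le hij (Fin.le_last j)))
    induction j using Fin.lastCases with
    | last =>
      refine ⟨?_, rfl⟩
      rw [hq] at h
      have := @hinj i ⟨0, hk⟩ (by simpa using h)
      subst this; rfl
    | cast j => exact absurd (hinj h) (by rintro rfl; exact lt_irrefl _ hij)
  · rintro ⟨hv, hn, hq⟩
    refine ⟨hk, hv, ?_, hq⟩
    intro i j h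
    rcases lt_trichotomy i j with hij | hij | hij
    · exact absurd (hn _ _ (Fin.castSucc_lt_castSucc_iff.mpr hij) h).2 (Fin.castSucc_lt_last j).ne
    · exact hij
    · exact absurd (hn _ _ (Fin.castSucc_lt_castSucc_iff.mpr hij) h.symm).2
        (Fin.castSucc_lt_last i).ne

/-- Open and closed trails are merged into one condition that is invariant under injective maps, in
particular under translation. -/
theorem isTrail_iff (hk : 1 ≤ k) : Γ.IsTrail q ↔
    (∀ i, q i ∈ Γ.verts) ∧ NearlyInjective q := by
  unfold InvDigraph.IsTrail
  rw [isClosedTrail_iff hk]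
  constructor
  · rintro (⟨hv, hinj⟩ | ⟨hv, hn, -⟩)
    · exact ⟨hv, fun i j hij h => absurd (hinj h) hij.ne⟩
    · exact ⟨hv, hn⟩
  · rintro ⟨hv, hn⟩
    by_cases hq : q (Fin.last k) = q 0
    · exact Or.inr ⟨hv, hn, hq⟩
    · refine Or.inl ⟨hv, ?_⟩
      intro i j h
      rcases lt_trichotomy i j with hij | hij | hij
      · obtain ⟨rfl, rfl⟩ := hn _ _ hij h; exact absurd h.symm hq
      · exact hij
      · obtain ⟨rfl, rfl⟩ := hn _ _ hij h.symm; exact absurd h hq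

theorem finite_trails (hV : Γ.verts.Finite) {P : (Fin (k + 1) → V) → Prop}
    (hP : ∀ q, P q → ∀ i, q i ∈ Γ.verts) : {q | P q}.Finite :=
  (Set.Finite.pi' (fun _ : Fin (k + 1) => hV)).subset fun q hq i => hP q hq i

end Trails

/-! ### Elements of order `k` and translates of trails -/

section PreorderSets

variable {X : Type*} {H : Subgroup (FreeGroup X)} {k : ℕ}

theorem mem_preorderSet_iff {G : Type*} [Group G] {S : Set G} {g : G} (hk : 1 ≤ k) :
    g ∈ preorderSet S k ↔ g ^ k ∈ S ∧ ∀ j, 1 ≤ j → j < k → g ^ j ∉ S := by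
  unfold preorderSet relOrder
  rw [Set.mem_ofPred_eq]
  constructor
  · intro h
    -- Since `k ≥ 1`, the order `k` is not the default value `0` of the infimum of the empty set.
    have hne : {k : ℕ | 1 ≤ k ∧ g ^ k ∈ S}.Nonempty := by
      by_contra hemp
      rw [Set.not_nonempty_iff_eq_empty] at hemp
      rw [hemp, Nat.sInf_empty] at h
      omega
    have hm := Nat.sInf_mem hne
    rw [h] at hm
    refine ⟨hm.2, fun j hj hjk hjS => ?_⟩
    have := Nat.sInf_le (s := {k : ℕ | 1 ≤ k ∧ g ^ k ∈ S}) ⟨hj, hjS⟩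
    omega
  · rintro ⟨h₁, h₂⟩
    apply le_antisymm (Nat.sInf_le (show k ∈ {k : ℕ | 1 ≤ k ∧ g ^ k ∈ S} from ⟨hk, h₁⟩))
    have hm := Nat.sInf_mem (s := {k : ℕ | 1 ≤ k ∧ g ^ k ∈ S}) ⟨k, hk, h₁⟩
    by_contra hlt
    exact h₂ _ hm.1 (not_le.mp hlt) hm.2

theorem cosetVertex_mul_eq_iff {g g' w : FreeGroup X} :
    cosetVertex H (g * w) = cosetVertex H (g' * w) ↔ cosetVertex H g = cosetVertex H g' := by
  rw [← move_cosetVertex, ← move_cosetVertex]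
  exact (move_injective w).eq_iff

theorem mem_preorderSet_rCoset_iff (hk : 1 ≤ k) {u z : FreeGroup X} :
    z ∈ preorderSet (rCoset H u) k ↔
      NearlyInjective (fun i : Fin (k + 1) => cosetVertex H (z ^ (i : ℕ))) ∧
        cosetVertex H (z ^ k) = cosetVertex H u := by
  rw [mem_preorderSet_iff hk, and_comm]
  simp only [mem_rCoset_iff]
  refine and_congr_left fun hu => ?_
  rw [← hu]
  constructor
  · intro h i j hij hz
    by_contra hne
    have hlt : (i : ℕ) < j := hij
    have hj : (j : ℕ) ≤ k := Nat.lt_succ_iff.mp j.2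
    -- Translating the coincidence by `z^(k-j)` shows that `z^(i+k-j)` is already in `Hu`. This
    -- exponent is below `k`, and it is at least `1` unless `i = 0` and `j = k`.
    have h1 : cosetVertex H (z ^ ((i : ℕ) + (k - j))) = cosetVertex H (z ^ k) := by
      have hk' : k = (j : ℕ) + (k - j) := by omega
      conv_rhs => rw [hk']
      rw [pow_add, pow_add, cosetVertex_mul_eq_iff]
      exact hz
    refine h ((i : ℕ) + (k - j)) ?_ (by omega) h1
    by_contra hlt'
    exact hne ⟨Fin.ext (by rw [Fin.val_zero]; omega), Fin.ext (by rw [Fin.val_last]; omega)⟩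
  · intro h j hj hjk hz
    have := h ⟨j, by omega⟩ (Fin.last k) (by rw [Fin.lt_def]; simpa using hjk) (by simpa using hz)
    have := congrArg Fin.val this.1
    simp at this
    omega

theorem rCoset_one : rCoset H 1 = (H : Set (FreeGroup X)) := by
  ext x
  rw [mem_rCoset_iff, cosetVertex_eq_base_iff, SetLike.mem_coe]

/-- Conjugating by `g` amounts to translating the trail by `g`. Once its start is at `H`, following
`z` step by step forces the entries `H z^i`. -/
theorem conj_mem_preorbit_iff {q : Fin (k + 1) → RightCosets H} {g z : FreeGroup X}
    (hg : move (q 0) g = cosetVertex H 1) :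
    g * z * g⁻¹ ∈ (schreier H).preorbit q ↔ ∀ i, move (q i) g = cosetVertex H (z ^ (i : ℕ)) := by
  rw [mem_preorbit_iff]
  constructor
  · intro h i
    induction i using Fin.induction with
    | zero => simpa using hg
    | succ i ih =>
      rw [← h i, ← move_mul, show g * z * g⁻¹ * g = g * z by group, move_mul, ih,
        move_cosetVertex, Fin.val_succ, pow_succ, Fin.val_castSucc]
  · intro h i
    rw [move_mul, move_mul, h, move_eq_iff, inv_inv, h, move_cosetVertex, Fin.val_castSucc,
      Fin.val_succ, pow_succ]

/-- The two left cosets consist of all elements that carry `q 0` to `H` and the last vertex to `Hu`,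
respectively. The right-hand side no longer involves `v` and `v'`. -/
theorem mem_conjSet_trail_iff {q : Fin (k + 1) → RightCosets H} {u v v' z : FreeGroup X}
    (hv : move (q 0) v = cosetVertex H 1) (hv' : move (q (Fin.last k)) v' = cosetVertex H u) :
    z ∈ conjSet ((schreier H).preorbit q) (lCoset v H ∩ lCoset v' (conjSubgroup H u)) ↔
      ∃ g, (∀ i, move (q i) g = cosetVertex H (z ^ (i : ℕ))) ∧
        move (q (Fin.last k)) g = cosetVertex H u := by
  have h₁ : ∀ g, g ∈ lCoset v H ↔ move (q 0) g = cosetVertex H 1 := by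
    intro g
    rw [move_eq_iff.mp hv, ← move_mul, ← mem_iff_move]
    constructor
    · rintro ⟨h, hh, rfl⟩; simpa using hh
    · intro h; exact ⟨_, h, by group⟩
  have h₂ : ∀ g, g ∈ lCoset v' (conjSubgroup H u) ↔
      move (q (Fin.last k)) g = cosetVertex H u := by
    intro g
    rw [move_eq_iff.mp hv', ← move_mul, ← mem_conjSubgroup_iff_move]
    constructor
    · rintro ⟨h, hh, rfl⟩; simpa using hh
    · intro h; exact ⟨_, h, by group⟩
  constructor
  · rintro ⟨w, hw, g, ⟨hg₁, hg₂⟩, rfl⟩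
    rw [h₁] at hg₁
    rw [h₂] at hg₂
    refine ⟨g, (conj_mem_preorbit_iff hg₁).mp ?_, hg₂⟩
    simpa [mul_assoc] using hw
  · rintro ⟨g, hg, hg₂⟩
    have hg₁ : move (q 0) g = cosetVertex H 1 := by simpa using hg 0
    exact ⟨g * z * g⁻¹, (conj_mem_preorbit_iff hg₁).mpr hg, g, ⟨(h₁ g).mpr hg₁, (h₂ g).mpr hg₂⟩,
      by group⟩

theorem mem_conjSet_closedTrail_iff {q : Fin (k + 1) → RightCosets H} {v z : FreeGroup X}
    (hv : move (q 0) v = cosetVertex H 1) :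
    z ∈ conjSet ((schreier H).preorbit q) {v} ↔
      ∀ i, move (q i) v = cosetVertex H (z ^ (i : ℕ)) := by
  rw [← conj_mem_preorbit_iff hv]
  constructor
  · rintro ⟨w, hw, g, rfl, rfl⟩; simpa [mul_assoc] using hw
  · intro h; exact ⟨_, h, v, rfl, by group⟩

/-- Every element is a conjugate of a cyclically reduced word, without cancellation. -/
theorem exists_cyclic_decomposition [DecidableEq X] (z : FreeGroup X) :
    ∃ C D : List (Letter X), FreeGroup.IsCyclicallyReduced D ∧
      (∀ m, m ≠ 0 → FreeGroup.IsReduced (C ++ (List.replicate m D).flatten ++ FreeGroup.invRev C)) ∧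
      (∀ m, z ^ m * FreeGroup.mk C = FreeGroup.mk (C ++ (List.replicate m D).flatten)) ∧
      (D = [] → z = 1) := by
  have hred : FreeGroup.IsReduced z.toWord := FreeGroup.isReduced_toWord
  have hD := FreeGroup.reduceCyclically.isCyclicallyReduced hred
  have hz := FreeGroup.reduceCyclically.conj_conjugator_reduceCyclically z.toWord
  generalize FreeGroup.reduceCyclically.conjugator z.toWord = C at hz
  generalize FreeGroup.reduceCyclically z.toWord = D at hz hD
  have hz' : z = FreeGroup.mk C * FreeGroup.mk D * (FreeGroup.mk C)⁻¹ := by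
    rw [FreeGroup.inv_mk, FreeGroup.mul_mk, FreeGroup.mul_mk, hz, FreeGroup.mk_toWord]
  refine ⟨C, D, hD, fun m hm => ?_, fun m => ?_, ?_⟩
  · exact FreeGroup.IsReduced.append_flatten_replicate_append hD (hz.symm ▸ hred) hm
  · rw [← FreeGroup.mul_mk, ← FreeGroup.pow_mk, hz', conj_pow]; group
  · rintro rfl
    rw [hz', ← FreeGroup.one_eq_mk]; group

theorem mem_cosetStallings_verts {u : FreeGroup X} {L₁ L₂ : List (Letter X)}
    (hred : FreeGroup.IsReduced (L₁ ++ L₂))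
    (hu : cosetVertex H (FreeGroup.mk (L₁ ++ L₂)) = cosetVertex H u) :
    cosetVertex H (FreeGroup.mk L₁) ∈ (cosetStallings H u).verts := by
  refine ⟨Set.mem_univ _, L₁, L₂, hred, ?_, ?_⟩
  · rw [schreier_isWalk_iff]; simp
  · rw [schreier_isWalk_iff, ← hu, move_cosetVertex, FreeGroup.mul_mk]

/-- The trail of an element of order `k` has a translate in the coset Stallings automaton. -/
theorem exists_move_mem_cosetStallings [DecidableEq X] (hk : 1 ≤ k) {u z : FreeGroup X}
    (hz : cosetVertex H (z ^ k) = cosetVertex H u) :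
    ∃ c, ∀ i ≤ k, cosetVertex H (z ^ i * c) ∈ (cosetStallings H u).verts := by
  obtain ⟨C, D, -, hred, hpow, -⟩ := exists_cyclic_decomposition z
  -- For `i ≤ k` the word `C D^i` is a prefix of `C D^k C⁻¹`, the reduced word of `z^k`.
  refine ⟨FreeGroup.mk C, fun i hi => ?_⟩
  rw [hpow]
  have hsplit : (C ++ (List.replicate i D).flatten) ++
      ((List.replicate (k - i) D).flatten ++ FreeGroup.invRev C) =
      C ++ (List.replicate k D).flatten ++ FreeGroup.invRev C := by
    have : k = i + (k - i) := by omega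
    conv_rhs => rw [this]
    rw [List.replicate_add, List.flatten_append]
    simp only [List.append_assoc]
  refine mem_cosetStallings_verts (L₂ := (List.replicate (k - i) D).flatten ++ FreeGroup.invRev C)
    ?_ ?_
  · rw [hsplit]; exact hred k (by omega)
  · rw [hsplit, ← FreeGroup.mul_mk, ← hpow, ← FreeGroup.inv_mk, mul_inv_cancel_right, hz]

theorem exists_trail_iff [DecidableEq X] (hk : 1 ≤ k) {u z : FreeGroup X} :
    z ∈ preorderSet (rCoset H u) k ↔
      ∃ q : Fin (k + 1) → RightCosets H, (cosetStallings H u).IsTrail q ∧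
        ∃ g, (∀ i, move (q i) g = cosetVertex H (z ^ (i : ℕ))) ∧
          move (q (Fin.last k)) g = cosetVertex H u := by
  rw [mem_preorderSet_rCoset_iff hk]
  constructor
  · rintro ⟨hn, hu⟩
    obtain ⟨c, hc⟩ := exists_move_mem_cosetStallings hk hu
    refine ⟨fun i => cosetVertex H (z ^ (i : ℕ) * c), (isTrail_iff hk).mpr ⟨fun i => ?_, ?_⟩,
      c⁻¹, fun i => by simp, by simpa using hu⟩
    · exact hc i (Nat.lt_succ_iff.mp i.2)
    · exact (nearlyInjective_comp_iff (move_injective c)).mpr hn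
  · rintro ⟨q, hq, g, hg, hu⟩
    refine ⟨?_, ?_⟩
    · simp_rw [← hg]
      exact (nearlyInjective_comp_iff (move_injective g)).mpr ((isTrail_iff hk).mp hq).2
    · rw [← hu, hg]; simp

theorem trail_description [DecidableEq X] (hH : H.FG) (u : FreeGroup X) (hk : 1 ≤ k) :
    {q : Fin (k + 1) → RightCosets H | (cosetStallings H u).IsTrail q}.Finite ∧
      ∀ v v' : (Fin (k + 1) → RightCosets H) → FreeGroup X,
        (∀ q, (cosetStallings H u).IsTrail q →
          (schreier H).Reads (q 0) (v q) (cosetVertex H 1) ∧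
          (schreier H).Reads (q (Fin.last k)) (v' q) (cosetVertex H u)) →
        ((fun q => conjSet ((schreier H).preorbit q)
            (lCoset (v q) H ∩ lCoset (v' q) (conjSubgroup H u))) ''
          {q : Fin (k + 1) → RightCosets H |
            (cosetStallings H u).IsTrail q}).PairwiseDisjoint id ∧
        preorderSet (rCoset H u) k =
          ⋃ q ∈ {q : Fin (k + 1) → RightCosets H | (cosetStallings H u).IsTrail q},
            conjSet ((schreier H).preorbit q)
              (lCoset (v q) H ∩ lCoset (v' q) (conjSubgroup H u)) := by
  refine ⟨finite_trails (finite_cosetStallings_verts hH u)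
    fun q hq => ((isTrail_iff hk).mp hq).1, fun v v' hv => ?_⟩
  simp only [schreier_reads_iff] at hv
  have key : ∀ q, (cosetStallings H u).IsTrail q → ∀ z, z ∈ conjSet ((schreier H).preorbit q)
      (lCoset (v q) H ∩ lCoset (v' q) (conjSubgroup H u)) ↔
      ∃ g, (∀ i, move (q i) g = cosetVertex H (z ^ (i : ℕ))) ∧
        move (q (Fin.last k)) g = cosetVertex H u :=
    fun q hq z => mem_conjSet_trail_iff (hv q hq).1 (hv q hq).2
  constructor
  · rintro _ ⟨q, hq, rfl⟩ _ ⟨q', hq', rfl⟩ hne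
    by_contra hdis
    apply hne
    obtain ⟨z, hz, hz'⟩ := Set.not_disjoint_iff.mp hdis
    obtain ⟨g, hg, -⟩ := (key q hq z).mp hz
    obtain ⟨g', hg', -⟩ := (key q' hq' z).mp hz'
    -- A common element makes the two trails translates of each other, and the term of the union
    -- depends only on the translation class of the trail.
    have hqq : ∀ i, q i = move (q' i) (g' * g⁻¹) := fun i => by
      rw [move_mul, hg', ← hg, ← move_mul]; simp
    ext y
    refine (key q hq y).trans (Iff.trans ?_ (key q' hq' y).symm)
    simp only [hqq, ← move_mul]
    constructor
    · rintro ⟨x, hx⟩; exact ⟨_, hx⟩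
    · rintro ⟨x, hx⟩; exact ⟨(g' * g⁻¹)⁻¹ * x, by simpa only [mul_inv_cancel_left] using hx⟩
  · ext z
    rw [exists_trail_iff hk]
    simp only [Set.mem_iUnion, Set.mem_ofPred_eq, exists_prop]
    exact exists_congr fun q => and_congr_right fun hq => (key q hq z).symm

end PreorderSets

/-! ### Hanging trees -/

section HangingTrees

variable {X : Type*} {H : Subgroup (FreeGroup X)}

theorem cosetStallings_arc_iff {u : FreeGroup X} {p q : RightCosets H} {a : Letter X} :
    (cosetStallings H u).arc p a q ↔ move p (FreeGroup.mk [a]) = q ∧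
      p ∈ (cosetStallings H u).verts ∧ q ∈ (cosetStallings H u).verts := by
  rw [← schreier_arc_iff]
  constructor
  · rintro ⟨h, hp, hq⟩; exact ⟨h, ⟨Set.mem_univ _, hp⟩, ⟨Set.mem_univ _, hq⟩⟩
  · rintro ⟨h, hp, hq⟩; exact ⟨h, hp.2, hq.2⟩

/-- A walk that starts in a hanging tree stays there until it reaches the root of the tree. -/
theorem branch_walk_or {u : FreeGroup X} {T : Set (RightCosets H)} {a : RightCosets H}
    (hT : (cosetStallings H u).IsHangingTree T a) {x : RightCosets H} {L : List (Letter X)}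
    (hx : x ∈ T) (hxa : x ≠ a) (hL : StaysIn (cosetStallings H u).verts x L) :
    (∃ M, M <+: L ∧ ((cosetStallings H u).branch T a).IsWalk x M a) ∨
      ((cosetStallings H u).branch T a).IsWalk x L (move x (FreeGroup.mk L)) := by
  induction L generalizing x with
  | nil =>
    right
    rw [← FreeGroup.one_eq_mk, move_one]
    exact ⟨⟨hL.start, hx⟩, rfl⟩
  | cons l L ih =>
    have hL' := StaysIn.of_append (L := [l]) (M := L) hL
    have harc : (cosetStallings H u).arc x l (move x (FreeGroup.mk [l])) :=
      cosetStallings_arc_iff.mpr ⟨rfl, hL.start, hL'.start⟩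
    have hy := hT.2.2.2 x hx hxa l _ harc
    have hb : ((cosetStallings H u).branch T a).arc x l (move x (FreeGroup.mk [l])) :=
      ⟨harc, hx, hy, Or.inl hxa⟩
    rw [mk_cons, move_mul]
    by_cases hya : move x (FreeGroup.mk [l]) = a
    · left
      refine ⟨[l], ⟨L, rfl⟩, _, hb, ?_, hya⟩
      exact ⟨hL'.start, hy⟩
    · rcases ih hy hya hL' with ⟨M, hM, hw⟩ | hw
      · exact Or.inl ⟨l :: M, by simpa using hM, _, hb, hw⟩
      · exact Or.inr ⟨_, hb, hw⟩

/-- Off the root `a`, both `D` and `D⁻¹` would have to lead from `x` to `a` before closing up.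
Uniqueness of reduced walks in a tree makes the two initial segments equal, so `D` and `D⁻¹` begin
with the same letter `b`. Then `D` begins with `b` and ends with `b⁻¹`, against cyclic reducedness.
-/
theorem not_mem_hangingTree {u : FreeGroup X} {x : RightCosets H} {D : List (Letter X)}
    (hD : FreeGroup.IsCyclicallyReduced D) (hne : D ≠ []) (hx : move x (FreeGroup.mk D) = x)
    (hs : StaysIn (cosetStallings H u).verts x D) :
    ¬ ∃ T a, (cosetStallings H u).IsHangingTree T a ∧ x ∈ T ∧ x ≠ a := by
  rintro ⟨T, a, hT, hxT, hxa⟩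
  have hxv : x ∈ ((cosetStallings H u).branch T a).verts := ⟨hs.start, hxT⟩
  have hav : a ∈ ((cosetStallings H u).branch T a).verts := ⟨hT.1 hT.2.1, hT.2.1⟩
  -- If the closed walk never reached the root, it would be a second reduced walk from `x` to `x` in
  -- the tree, besides the empty one.
  have hloop : ∀ L, FreeGroup.IsReduced L → L ≠ [] → move x (FreeGroup.mk L) = x →
      StaysIn (cosetStallings H u).verts x L →
      ∃ M, M <+: L ∧ ((cosetStallings H u).branch T a).IsWalk x M a := by
    intro L hL hne hx hs
    rcases branch_walk_or hT hxT hxa hs with h | h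
    · exact h
    · rw [hx] at h
      have hnil : FreeGroup.IsReduced ([] : List (Letter X)) ∧
          ((cosetStallings H u).branch T a).IsWalk x [] x := ⟨by simp, hxv, rfl⟩
      exact absurd ((hT.2.2.1.2 x hxv x hxv).unique ⟨hL, h⟩ hnil) hne
  have hDr : FreeGroup.IsReduced (FreeGroup.invRev D) := by
    classical
    rw [FreeGroup.isReduced_iff_reduce_eq, FreeGroup.reduce_invRev, hD.isReduced.reduce_eq]
  have hs' := hs.invRev
  rw [hx] at hs'
  obtain ⟨M, hM, hMw⟩ := hloop D hD.isReduced hne hx hs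
  obtain ⟨M', hM', hMw'⟩ := hloop (FreeGroup.invRev D) hDr
    (by simpa [FreeGroup.invRev] using hne)
    (by rw [← FreeGroup.inv_mk, ← move_eq_iff.mp hx]) hs'
  have hMM : M = M' := (hT.2.2.1.2 x hxv a hav).unique
    ⟨hD.isReduced.infix hM.isInfix, hMw⟩ ⟨hDr.infix hM'.isInfix, hMw'⟩
  subst hMM
  cases M with
  | nil => exact hxa hMw.2
  | cons b M =>
    obtain ⟨R, hR⟩ := hM
    obtain ⟨R', hR'⟩ := hM'
    have h₁ : D.head? = some b := by rw [← hR]; rfl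
    have h₂ : D.getLast? = some (b.1, !b.2) := by
      rw [← FreeGroup.invRev_invRev (L₁ := D), ← hR']
      simp [FreeGroup.invRev]
    have := hD.2 _ h₂ _ h₁ rfl
    simp at this

variable {k : ℕ}

theorem exists_move_mem_restrictedStallings_of_ne_one [DecidableEq X] (hk : 1 ≤ k)
    {z : FreeGroup X} (hz : z ^ k ∈ H) (hz1 : z ≠ 1) :
    ∃ c, ∀ i ≤ k, cosetVertex H (z ^ i * c) ∈ (restrictedStallings H).verts := by
  obtain ⟨C, D, hD, hred, hpow, hD1⟩ := exists_cyclic_decomposition z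
  have hne : D ≠ [] := fun h => hz1 (hD1 h)
  refine ⟨FreeGroup.mk C, fun i hi => ?_⟩
  -- The closed walk `D^k` starts after the prefix `C D^i`, so `z^k` may be too short to contain it.
  -- The reduced word `C D^(2k) C⁻¹` of `z^(2k) ∈ H` has room for it.
  have hstay : StaysIn (cosetStallings H 1).verts (cosetVertex H (z ^ i * FreeGroup.mk C))
      (List.replicate k D).flatten := by
    rintro M ⟨R, hR⟩
    rw [hpow, move_cosetVertex, FreeGroup.mul_mk]
    have hsplit : (C ++ (List.replicate i D).flatten ++ M) ++
        (R ++ (List.replicate (k - i) D).flatten ++ FreeGroup.invRev C) =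
        C ++ (List.replicate (k + k) D).flatten ++ FreeGroup.invRev C := by
      have : k + k = i + k + (k - i) := by omega
      rw [this, List.replicate_add, List.replicate_add, List.flatten_append, List.flatten_append,
        ← hR]
      simp only [List.append_assoc]
    refine mem_cosetStallings_verts
      (L₂ := R ++ (List.replicate (k - i) D).flatten ++ FreeGroup.invRev C) ?_ ?_
    · rw [hsplit]; exact hred _ (by omega)
    · rw [hsplit, ← FreeGroup.mul_mk, ← hpow, ← FreeGroup.inv_mk, mul_inv_cancel_right,
        cosetVertex_eq_base_iff, pow_add]
      exact H.mul_mem hz hz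
  refine ⟨hstay.start, ?_⟩
  refine not_mem_hangingTree (hD.flatten_replicate k) ?_ ?_ hstay
  · have : k ≠ 0 := by omega
    simp [hne, this]
  · rw [move_cosetVertex, hpow, FreeGroup.mul_mk, List.append_assoc, ← List.flatten_append,
      ← List.replicate_add, ← hpow, ← hpow, cosetVertex_mul_eq_iff, cosetVertex_eq_iff, add_comm,
      pow_add]
    simpa using H.inv_mem hz

/-- This serves `z = 1`, where no cycle is available. A nontrivial element of `H` supplies a vertex
on a cycle. For trivial `H` the automaton is a single vertex, which can only be the root of a
hanging tree and so is kept. -/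
theorem restrictedStallings_verts_nonempty [DecidableEq X] :
    (restrictedStallings H).verts.Nonempty := by
  by_cases hH : H = ⊥
  · subst hH
    have hbase : ∀ v ∈ (cosetStallings (⊥ : Subgroup (FreeGroup X)) 1).verts,
        v = cosetVertex ⊥ 1 := by
      rintro v ⟨-, L₁, L₂, hred, h₁, h₂⟩
      rw [schreier_isWalk_iff] at h₁ h₂
      have : FreeGroup.mk (L₁ ++ L₂) ∈ (⊥ : Subgroup (FreeGroup X)) := by
        rw [mem_iff_move, ← FreeGroup.mul_mk, move_mul, h₁, h₂]
      rw [Subgroup.mem_bot, ← FreeGroup.toWord_eq_nil_iff, FreeGroup.toWord_mk, hred.reduce_eq,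
        List.append_eq_nil_iff] at this
      rw [← h₁, this.1, ← FreeGroup.one_eq_mk, move_one]
    refine ⟨cosetVertex ⊥ 1, ?_, ?_⟩
    · exact mem_cosetStallings_verts (L₁ := []) (L₂ := []) (by simp) rfl
    · rintro ⟨T, a, hT, -, hne⟩
      exact hne (hbase a (hT.1 hT.2.1)).symm
  · obtain ⟨z, hz, hz1⟩ := H.bot_or_exists_ne_one.resolve_left hH
    obtain ⟨c, hc⟩ := exists_move_mem_restrictedStallings_of_ne_one (k := 1) le_rfl
      (by simpa using hz) hz1
    exact ⟨_, hc 0 zero_le_one⟩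

theorem exists_move_mem_restrictedStallings [DecidableEq X] (hk : 1 ≤ k) {z : FreeGroup X}
    (hz : z ^ k ∈ H) :
    ∃ c, ∀ i ≤ k, cosetVertex H (z ^ i * c) ∈ (restrictedStallings H).verts := by
  by_cases hz1 : z = 1
  · obtain ⟨p, hp⟩ := restrictedStallings_verts_nonempty (H := H)
    obtain ⟨g, rfl⟩ := exists_cosetVertex p
    exact ⟨g, fun i _ => by simpa [hz1] using hp⟩
  · exact exists_move_mem_restrictedStallings_of_ne_one hk hz hz1

theorem closedTrail_description [DecidableEq X] (hH : H.FG) (hk : 1 ≤ k) :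
    {q : Fin (k + 1) → RightCosets H | (restrictedStallings H).IsClosedTrail q}.Finite ∧
      ∀ v : (Fin (k + 1) → RightCosets H) → FreeGroup X,
        (∀ q, (restrictedStallings H).IsClosedTrail q →
          (schreier H).Reads (q 0) (v q) (cosetVertex H 1)) →
        ((fun q => conjSet ((schreier H).preorbit q) {v q}) ''
          {q : Fin (k + 1) → RightCosets H |
            (restrictedStallings H).IsClosedTrail q}).PairwiseDisjoint id ∧
        preorderSet (H : Set (FreeGroup X)) k =
          conjSet
            (⋃ q ∈ {q : Fin (k + 1) → RightCosets H | (restrictedStallings H).IsClosedTrail q},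
              conjSet ((schreier H).preorbit q) {v q})
            (H : Set (FreeGroup X)) := by
  have hfin : (restrictedStallings H).verts.Finite :=
    (finite_cosetStallings_verts hH 1).subset fun x hx => hx.1
  refine ⟨finite_trails hfin fun q hq => ((isClosedTrail_iff hk).mp hq).1, fun v hv => ?_⟩
  simp only [schreier_reads_iff] at hv
  have key : ∀ q, (restrictedStallings H).IsClosedTrail q → ∀ z,
      z ∈ conjSet ((schreier H).preorbit q) {v q} ↔
        ∀ i, move (q i) (v q) = cosetVertex H (z ^ (i : ℕ)) :=
    fun q hq z => mem_conjSet_closedTrail_iff (hv q hq)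
  constructor
  · rintro _ ⟨q, hq, rfl⟩ _ ⟨q', hq', rfl⟩ hne
    by_contra hdis
    apply hne
    obtain ⟨z, hz, hz'⟩ := Set.not_disjoint_iff.mp hdis
    have h := (key q hq z).mp hz
    have h' := (key q' hq' z).mp hz'
    -- Membership of `y` in either set now says that `H y^i = H z^i` for all `i ≤ k`.
    ext y
    refine (key q hq y).trans (Iff.trans ?_ (key q' hq' y).symm)
    simp only [h, h']
  · have hpre : preorderSet (H : Set (FreeGroup X)) k = preorderSet (rCoset H 1) k := by
      rw [rCoset_one]
    rw [hpre]
    ext z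
    rw [mem_preorderSet_rCoset_iff hk]
    constructor
    · rintro ⟨hn, hu⟩
      obtain ⟨c, hc⟩ := exists_move_mem_restrictedStallings hk (cosetVertex_eq_base_iff.mp hu)
      set q : Fin (k + 1) → RightCosets H := fun i => cosetVertex H (z ^ (i : ℕ) * c) with hqdef
      have hq : (restrictedStallings H).IsClosedTrail q := by
        refine (isClosedTrail_iff hk).mpr ⟨fun i => hc i (Nat.lt_succ_iff.mp i.2), ?_, ?_⟩
        · exact (nearlyInjective_comp_iff (move_injective c)).mpr hn
        · simpa [hqdef] using cosetVertex_mul_eq_iff.mpr hu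
      have hh : c * v q ∈ H := by
        have := hv q hq
        simpa [hqdef, cosetVertex_eq_base_iff] using this
      -- The translation by `c` followed by `v q` fixes the base vertex, so `c * v q` lies in `H`.
      -- Conjugation by it translates the cosets `H z^i` onto the images of the trail under `v q`.
      refine ⟨(c * v q)⁻¹ * z * (c * v q), ?_, (c * v q)⁻¹, ?_, by group⟩
      · simp only [Set.mem_iUnion, Set.mem_ofPred_eq, exists_prop]
        refine ⟨q, hq, (key q hq _).mpr fun i => ?_⟩
        have hcp : ∀ j : ℕ, ((c * v q)⁻¹ * z * (c * v q)) ^ j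
            = (c * v q)⁻¹ * z ^ j * (c * v q) := fun j => by
          simpa using conj_pow (a := (c * v q)⁻¹) (b := z) (i := j)
        have hqi : q i = cosetVertex H (z ^ (i : ℕ) * c) := rfl
        rw [hqi, hcp, move_cosetVertex, cosetVertex_eq_iff]
        convert H.inv_mem hh using 1
        group
      · exact H.inv_mem hh
    · rintro ⟨y, hy, h, hh, rfl⟩
      rw [SetLike.mem_coe] at hh
      simp only [Set.mem_iUnion, Set.mem_ofPred_eq, exists_prop] at hy
      obtain ⟨q, hq, hyq⟩ := hy
      rw [key q hq] at hyq
      obtain ⟨-, hn, hc⟩ := (isClosedTrail_iff hk).mp hq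
      have hcp : ∀ j : ℕ, cosetVertex H ((h⁻¹ * y * h) ^ j) =
          move (cosetVertex H (y ^ j)) h := fun j => by
        have : (h⁻¹ * y * h) ^ j = h⁻¹ * y ^ j * h := by
          simpa using conj_pow (a := h⁻¹) (b := y) (i := j)
        rw [this, move_cosetVertex, cosetVertex_eq_iff]
        convert hh using 1
        group
      constructor
      · simp_rw [hcp, ← hyq, ← move_mul]
        exact (nearlyInjective_comp_iff (move_injective _)).mpr hn
      · have := hyq (Fin.last k)
        rw [hc, hv q hq] at this
        rw [hcp, show k = ((Fin.last k : Fin (k + 1)) : ℕ) from rfl, ← this]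
        exact mem_iff_move.mp hh

end HangingTrees

/-! ### Primitive recursive list operations -/

namespace Primrec

variable {α β σ : Type*} [Primcodable α] [Primcodable β] [Primcodable σ]

theorem list_all {f : α → List β} {g : α → β → Bool} (hf : Primrec f) (hg : Primrec₂ g) :
    Primrec fun a => (f a).all (g a) := by
  refine (list_foldr (h := fun a p => g a p.1 && p.2) hf (const true)
    (Primrec.and.comp (hg.comp fst (fst.comp snd)) (snd.comp snd))).of_eq fun a => ?_
  induction f a with
  | nil => rfl
  | cons b l ih => simp [ih]

theorem list_any {f : α → List β} {g : α → β → Bool} (hf : Primrec f) (hg : Primrec₂ g) :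
    Primrec fun a => (f a).any (g a) := by
  refine (list_foldr (h := fun a p => g a p.1 || p.2) hf (const false)
    (Primrec.or.comp (hg.comp fst (fst.comp snd)) (snd.comp snd))).of_eq fun a => ?_
  induction f a with
  | nil => rfl
  | cons b l ih => simp [ih]

theorem list_filter_param {f : α → List β} {g : α → β → Bool} (hf : Primrec f)
    (hg : Primrec₂ g) : Primrec fun a => (f a).filter (g a) := by
  refine (list_foldr (h := fun a p => bif g a p.1 then p.1 :: p.2 else p.2) hf (const [])
    (Primrec.cond (hg.comp fst (fst.comp snd))
      (list_cons.comp (fst.comp snd) (snd.comp snd)) (snd.comp snd))).of_eq fun a => ?_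
  induction f a with
  | nil => rfl
  | cons b l ih =>
    rw [List.foldr_cons, ih, List.filter_cons]
    cases g a b <;> simp

theorem list_inits : Primrec (List.inits : List α → List (List α)) := by
  refine (list_foldr (f := fun l : List α => l) (g := fun _ => [[]])
    (h := fun _ p => [] :: p.2.map (fun l => p.1 :: l)) Primrec.id (const _)
    (list_cons.comp (const []) (list_map (snd.comp snd)
      (list_cons.comp (fst.comp (snd.comp fst)) snd)))).of_eq fun l => ?_
  induction l with
  | nil => rfl
  | cons a l ih => rw [List.foldr_cons, ih, List.inits_cons]

end Primrec

/-- The lists of length `k` with entries in `A`. -/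
def allLists {α : Type*} (A : List α) (k : ℕ) : List (List α) :=
  Nat.rec [[]] (fun _ ls => ls.flatMap fun l => A.map fun a => a :: l) k

theorem mem_allLists {α : Type*} {A : List α} {k : ℕ} {l : List α} :
    l ∈ allLists A k ↔ l.length = k ∧ ∀ a ∈ l, a ∈ A := by
  induction k generalizing l with
  | zero => cases l <;> simp [allLists]
  | succ k ih =>
    have hs : allLists A (k + 1) = (allLists A k).flatMap fun l => A.map fun a => a :: l := rfl
    rw [hs, List.mem_flatMap]
    constructor
    · rintro ⟨l', hl', hl⟩
      obtain ⟨a, ha, rfl⟩ := List.mem_map.mp hl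
      have := ih.mp hl'
      simp_all
    · rintro ⟨hlen, hA⟩
      cases l with
      | nil => simp at hlen
      | cons a l =>
        exact ⟨l, ih.mpr ⟨by simpa using hlen, fun b hb => hA b (by simp [hb])⟩,
          List.mem_map.mpr ⟨a, hA a (by simp), rfl⟩⟩

theorem primrec_allLists {α : Type*} [Primcodable α] :
    Primrec₂ (allLists : List α → ℕ → List (List α)) := by
  refine Primrec.nat_rec (f := fun _ : List α => [[]])
    (g := fun A p => p.2.flatMap fun l => A.map fun a => a :: l) (Primrec.const _) ?_
  refine Primrec.list_flatMap (Primrec.snd.comp Primrec.snd) ?_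
  refine Primrec.list_map (Primrec.fst.comp Primrec.fst) ?_
  exact Primrec.list_cons.comp Primrec.snd (Primrec.snd.comp Primrec.fst)

/-! ### The membership problem -/

section Membership

variable {n : ℕ}

/-- All letters. -/
noncomputable def letters (n : ℕ) : List (Letter (Fin n)) := Finset.univ.toList

theorem mem_letters (a : Letter (Fin n)) : a ∈ letters n := by simp [letters]

/-- The action of a letter that is described by a table. -/
noncomputable def tableAct (T : List (List ℕ)) (a : Letter (Fin n)) (i : ℕ) : ℕ :=
  (T.getD ((letters n).idxOf a) []).getD i 0

/-- The action of a word that is described by a table. -/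
noncomputable def tableRun (T : List (List ℕ)) (L : List (Letter (Fin n))) (i : ℕ) : ℕ :=
  L.foldl (fun i a => tableAct T a i) i

/-- The table describes permutations of `{0, …, m - 1}`, mutually inverse for inverse letters. -/
noncomputable def tableValid (n m : ℕ) (T : List (List ℕ)) : Bool :=
  (letters n).all fun a => (List.range m).all fun i =>
    decide (tableAct T a i < m) && (tableAct T (a.1, !a.2) (tableAct T a i) == i)

/-- The decision procedure for the membership problem: every finite permutation representation of
a certain degree is inspected. -/
noncomputable def memSpan (S : List (List (Letter (Fin n)))) (w : List (Letter (Fin n))) : Bool :=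
  (allLists (allLists (List.range (prefixList S w).length) (prefixList S w).length)
    (letters n).length).all fun T => !tableValid n (prefixList S w).length T ||
      (List.range (prefixList S w).length).all fun i =>
        !(S.all fun s => tableRun T s i == i) || tableRun T w i == i

theorem tableValid_iff {m : ℕ} {T : List (List ℕ)} : tableValid n m T = true ↔
    ∀ (a : Letter (Fin n)) (i : ℕ), i < m →
      tableAct T a i < m ∧ tableAct T (a.1, !a.2) (tableAct T a i) = i := by
  simp [tableValid, mem_letters]

theorem tableRun_append (T : List (List ℕ)) (L M : List (Letter (Fin n))) (i : ℕ) :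
    tableRun T (L ++ M) i = tableRun T M (tableRun T L i) := by
  simp [tableRun]

theorem tableRun_cons (T : List (List ℕ)) (a : Letter (Fin n)) (M : List (Letter (Fin n)))
    (i : ℕ) : tableRun T (a :: M) i = tableRun T M (tableAct T a i) := rfl

/-! ### Valid tables as actions of the free group -/

section Valid

variable {m : ℕ} {T : List (List ℕ)}

theorem tableRun_lt (hT : tableValid n m T = true) (L : List (Letter (Fin n))) {i : ℕ} (hi : i < m) :
    tableRun T L i < m := by
  induction L generalizing i with
  | nil => exact hi
  | cons a L ih => exact ih (tableValid_iff.mp hT a i hi).1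

theorem tableRun_red (hT : tableValid n m T = true) {L M : List (Letter (Fin n))}
    (h : FreeGroup.Red L M) {i : ℕ} (hi : i < m) :
    tableRun T L i = tableRun T M i := by
  induction h with
  | refl => rfl
  | tail _ hs ih =>
    rw [ih]
    cases hs with
    | @not L₁ L₂ x b =>
      rw [tableRun_append, tableRun_append, tableRun_cons, tableRun_cons,
        (tableValid_iff.mp hT (x, b) _ (tableRun_lt hT L₁ hi)).2]

theorem tableRun_congr (hT : tableValid n m T = true) {L M : List (Letter (Fin n))}
    (h : FreeGroup.mk L = FreeGroup.mk M) {i : ℕ} (hi : i < m) : tableRun T L i = tableRun T M i := by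
  rw [tableRun_red hT FreeGroup.reduce.red hi, FreeGroup.reduce.sound h,
    ← tableRun_red hT FreeGroup.reduce.red hi]

/-- A valid table is an action of the free group on `{0, …, m - 1}`, so the stabilizer of `i` is a
subgroup and contains `H` as soon as it contains the generators. -/
theorem tableRun_eq_of_mem (hT : tableValid n m T = true) {S : List (List (Letter (Fin n)))}
    {i : ℕ} (hi : i < m) (hS : ∀ s ∈ S, tableRun T s i = i) {w : List (Letter (Fin n))}
    (hw : FreeGroup.mk w ∈ spanWords S) : tableRun T w i = i := by
  have key : ∀ g ∈ spanWords S, tableRun T g.toWord i = i := by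
    intro g hg
    refine Subgroup.closure_induction (p := fun g _ => tableRun T g.toWord i = i) ?_ ?_ ?_ ?_ hg
    · rintro _ ⟨s, hs, rfl⟩
      rw [tableRun_congr hT FreeGroup.mk_toWord hi, hS s hs]
    · simp [tableRun]
    · intro x y _ _ hx hy
      rw [tableRun_congr hT (M := x.toWord ++ y.toWord) (by
        rw [← FreeGroup.mul_mk]; simp only [FreeGroup.mk_toWord]) hi, tableRun_append, hx, hy]
    · intro x _ hx
      have h := tableRun_congr hT (L := x.toWord ++ x⁻¹.toWord) (M := []) (i := i) (by
        rw [← FreeGroup.mul_mk, ← FreeGroup.one_eq_mk]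
        simp only [FreeGroup.mk_toWord, mul_inv_cancel]) hi
      rwa [tableRun_append, hx] at h
  exact (tableRun_congr hT FreeGroup.mk_toWord.symm hi).trans (key _ hw)

end Valid

/-- A partial injection of a finite set extends to a permutation. -/
theorem exists_perm_extending {m : ℕ} {V : Type*} (e : V ↪ Fin m) (r : V → V → Prop)
    (hr : ∀ v a b, r v a → r v b → a = b) (hr' : ∀ a b v, r a v → r b v → a = b) :
    ∃ π : Equiv.Perm (Fin m), ∀ v v', r v v' → π (e v) = e v' := by
  classical
  let s : Set (Fin m) := {i | ∃ v v', e v = i ∧ r v v'}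
  have hs : ∀ i, ∃ j, ∀ v v', e v = i → r v v' → j = e v' := by
    intro i
    by_cases hi : ∃ v v', e v = i ∧ r v v'
    · obtain ⟨v, v', rfl, h⟩ := hi
      refine ⟨e v', fun a b hab hr₁ => ?_⟩
      rw [e.injective hab] at hr₁
      rw [hr _ _ _ h hr₁]
    -- Outside the domain `s` of the partial injection the value is arbitrary. Only the restriction
    -- to `s` is extended.
    · exact ⟨i, fun v v' hv h => absurd ⟨v, v', hv, h⟩ hi⟩
  choose f hf using hs
  obtain ⟨g, hg⟩ := Set.MapsTo.exists_equiv_extend_of_card_eq (α := Fin m) (β := Fin m)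
    (t := Finset.univ) (s := s) (f := f) (by simp) (fun _ _ => by simp) (by
      rintro _ ⟨a, a', rfl, ha⟩ _ ⟨b, b', rfl, hb⟩ hab
      rw [hf _ a a' rfl ha, hf _ b b' rfl hb] at hab
      rw [e.injective hab] at ha
      rw [hr' _ _ _ ha hb])
  refine ⟨g.trans (Equiv.subtypeUnivEquiv (by simp)), fun v v' h => ?_⟩
  have := hg (e v) ⟨v, v', rfl, h⟩
  rw [hf _ v v' rfl h] at this
  simpa using this

/-- The table of a family of permutations. -/
noncomputable def permTable {m : ℕ} (φ : Letter (Fin n) → Fin m → Fin m) : List (List ℕ) :=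
  (letters n).map fun a => List.ofFn fun i => (φ a i : ℕ)

theorem tableAct_permTable {m : ℕ} (φ : Letter (Fin n) → Fin m → Fin m) (a : Letter (Fin n))
    (i : Fin m) : tableAct (permTable φ) a i = φ a i := by
  have h : (letters n).idxOf a < (letters n).length := List.idxOf_lt_length_of_mem (mem_letters a)
  unfold tableAct permTable
  have hrow : ((letters n).map fun a => List.ofFn fun i => (φ a i : ℕ)).getD
      ((letters n).idxOf a) [] = List.ofFn fun i => (φ a i : ℕ) := by
    rw [List.getD_eq_getElem _ _ (by simpa using h), List.getElem_map, List.getElem_idxOf]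
  rw [hrow, List.getD_eq_getElem _ _ (by simp)]
  simp

theorem permTable_mem_allLists {m : ℕ} (φ : Letter (Fin n) → Fin m → Fin m) :
    permTable φ ∈ allLists (allLists (List.range m) m) (letters n).length := by
  rw [mem_allLists]
  refine ⟨by simp [permTable], fun l hl => ?_⟩
  obtain ⟨a, -, rfl⟩ := List.mem_map.mp hl
  rw [mem_allLists]
  refine ⟨by simp, fun i hi => ?_⟩
  obtain ⟨j, rfl⟩ := List.mem_ofFn.mp hi
  simp

/-- If `w` is outside `H`, the letters act as partial injections on the traced vertices, of which
there are at most as many as prefixes. Extended to permutations, they still carry each generator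
around a closed walk at the base point, but take the base point along `w` to the different vertex
`Hw`. Conversely, no action can separate an element of `H` from the generators. -/
theorem memSpan_iff {S : List (List (Letter (Fin n)))} {w : List (Letter (Fin n))} :
    memSpan S w = true ↔ FreeGroup.mk w ∈ spanWords S := by
  have hunfold : memSpan S w = true ↔ ∀ T ∈ allLists (allLists
      (List.range (prefixList S w).length) (prefixList S w).length) (letters n).length,
      tableValid n (prefixList S w).length T = true → ∀ i < (prefixList S w).length,
        (∀ s ∈ S, tableRun T s i = i) → tableRun T w i = i := by
    unfold memSpan
    rw [List.all_eq_true]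
    refine forall₂_congr fun T _ => ?_
    simp only [Bool.or_eq_true, Bool.not_eq_true', List.all_eq_true, List.mem_range, beq_iff_eq,
      ← Bool.not_eq_true, ← imp_iff_not_or]
  rw [hunfold]
  constructor
  · intro h
    by_contra hw
    generalize hm : (prefixList S w).length = m at h
    let V := tracedVerts S w
    have : Finite V := finite_tracedVerts
    have : Fintype V := Fintype.ofFinite V
    obtain ⟨e⟩ : Nonempty (V ↪ Fin m) := by
      apply Function.Embedding.nonempty_of_card_le
      rw [← Nat.card_eq_fintype_card, Nat.card_coe_set_eq, Fintype.card_fin, ← hm]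
      exact ncard_tracedVerts_le
    have hπ : ∀ x : Fin n, ∃ π : Equiv.Perm (Fin m), ∀ v v' : V,
        move v.1 (FreeGroup.mk [(x, true)]) = v'.1 → π (e v) = e v' := fun x =>
      exists_perm_extending e _ (fun v a b ha hb => Subtype.ext (ha.symm.trans hb))
        fun a b v ha hb => Subtype.ext (move_injective _ (ha.trans hb.symm))
    choose π hπ using hπ
    -- Only the positive letters are extended. Inverse letters get the inverse permutations, so that
    -- the table is valid.
    let φ : Letter (Fin n) → Fin m → Fin m := fun a => if a.2 then π a.1 else (π a.1).symm
    have hφ : ∀ (a : Letter (Fin n)) (v v' : V), move v.1 (FreeGroup.mk [a]) = v'.1 →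
        φ a (e v) = e v' := by
      rintro ⟨x, b⟩ v v' hv
      cases b with
      | true => exact hπ x v v' hv
      | false =>
        show (π x).symm (e v) = e v'
        rw [Equiv.symm_apply_eq]
        refine (hπ x v' v ?_).symm
        rw [move_eq_iff] at hv
        rw [hv]
        rfl
    have hvalid : tableValid n m (permTable φ) = true := by
      rw [tableValid_iff]
      intro a i hi
      have h₁ := tableAct_permTable φ a ⟨i, hi⟩
      have h₂ := tableAct_permTable φ (a.1, !a.2) (φ a ⟨i, hi⟩)
      simp only at h₁
      rw [h₁]
      refine ⟨(φ a ⟨i, hi⟩).2, ?_⟩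
      rw [h₂]
      obtain ⟨x, b⟩ := a
      cases b <;> simp [φ]
    have hrun : ∀ (L : List (Letter (Fin n))) (v v' : V), StaysIn V v.1 L →
        move v.1 (FreeGroup.mk L) = v'.1 → tableRun (permTable φ) L (e v) = e v' := by
      intro L
      induction L with
      | nil =>
        intro v v' _ hv
        rw [← FreeGroup.one_eq_mk, move_one] at hv
        rw [Subtype.ext hv]; rfl
      | cons a L ih =>
        intro v v' hs hv
        have hs' := StaysIn.of_append (L := [a]) (M := L) hs
        rw [mk_cons, move_mul] at hv
        rw [tableRun_cons, tableAct_permTable, hφ a v ⟨_, hs'.start⟩ rfl]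
        exact ih _ _ hs' hv
    let v₀ : V := ⟨_, base_mem_tracedVerts⟩
    have hfix := h _ (permTable_mem_allLists φ) hvalid (e v₀) (e v₀).2 (fun s hs =>
      hrun s v₀ v₀ (staysIn_of_mem_prefixList (mem_prefixList.mpr ⟨s, by simp [hs],
        List.prefix_rfl⟩)) (mem_iff_move.mp (mk_mem_spanWords hs)))
    have hwrun := hrun w v₀ ⟨_, target_mem_tracedVerts⟩ (staysIn_of_mem_prefixList
      (mem_prefixList.mpr ⟨w, by simp, List.prefix_rfl⟩)) (by simp [v₀])
    rw [hfix] at hwrun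
    have := congrArg Subtype.val (e.injective (Fin.ext hwrun))
    exact hw (cosetVertex_eq_base_iff.mp this.symm)
  · intro hw T _ hT i hi hS
    exact tableRun_eq_of_mem hT hi hS hw

theorem primrec_prefixList :
    Primrec₂ (prefixList : List (List (Letter (Fin n))) → List (Letter (Fin n)) → _) :=
  Primrec.list_flatMap (Primrec.list_cons.comp Primrec.snd Primrec.fst)
    (Primrec.list_inits.comp Primrec.snd)

/-! ### Primitive recursiveness of the membership test -/

section

variable {α : Type*} [Primcodable α]

theorem primrec_tableAct {T : α → List (List ℕ)} {a : α → Letter (Fin n)} {i : α → ℕ}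
    (hT : Primrec T) (ha : Primrec a) (hi : Primrec i) :
    Primrec fun x => tableAct (T x) (a x) (i x) :=
  (Primrec.list_getD 0).comp ((Primrec.list_getD []).comp hT
    ((Primrec.dom_finite fun b : Letter (Fin n) => (letters n).idxOf b).comp ha)) hi

theorem primrec_tableRun {T : α → List (List ℕ)} {L : α → List (Letter (Fin n))} {i : α → ℕ}
    (hT : Primrec T) (hL : Primrec L) (hi : Primrec i) :
    Primrec fun x => tableRun (T x) (L x) (i x) :=
  Primrec.list_foldl (h := fun x p => tableAct (T x) p.2 p.1) hL hi (primrec_tableAct (hT.comp Primrec.fst)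
    (Primrec.snd.comp Primrec.snd) (Primrec.fst.comp Primrec.snd))

theorem primrec_tableValid {m : α → ℕ} {T : α → List (List ℕ)} (hm : Primrec m)
    (hT : Primrec T) : Primrec fun x => tableValid n (m x) (T x) := by
  refine Primrec.list_all (Primrec.const _) ?_
  refine Primrec.list_all (Primrec.list_range.comp (hm.comp Primrec.fst)) ?_
  have hT' : Primrec fun x : (α × Letter (Fin n)) × ℕ => T x.1.1 :=
    hT.comp (Primrec.fst.comp Primrec.fst)
  have ha : Primrec fun x : (α × Letter (Fin n)) × ℕ => x.1.2 := Primrec.snd.comp Primrec.fst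
  have hact := primrec_tableAct hT' ha Primrec.snd
  refine Primrec.and.comp (Primrec.nat_lt.decide.comp hact
    (hm.comp (Primrec.fst.comp Primrec.fst))) (Primrec.beq.comp ?_ Primrec.snd)
  exact primrec_tableAct hT' (Primrec.pair (Primrec.fst.comp ha)
    (Primrec.not.comp (Primrec.snd.comp ha))) hact

theorem primrec_memSpan {S : α → List (List (Letter (Fin n)))} {w : α → List (Letter (Fin n))}
    (hS : Primrec S) (hw : Primrec w) : Primrec fun x => memSpan (S x) (w x) := by
  have hm : Primrec fun x => (prefixList (S x) (w x)).length :=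
    Primrec.list_length.comp (primrec_prefixList.comp hS hw)
  refine Primrec.list_all (primrec_allLists.comp (primrec_allLists.comp
    (Primrec.list_range.comp hm) hm) (Primrec.const _)) ?_
  refine Primrec.or.comp (Primrec.not.comp
    (primrec_tableValid (hm.comp Primrec.fst) Primrec.snd)) ?_
  refine Primrec.list_all (Primrec.list_range.comp (hm.comp Primrec.fst)) ?_
  refine Primrec.or.comp (Primrec.not.comp ?_) ?_
  · refine Primrec.list_all (hS.comp (Primrec.fst.comp Primrec.fst)) ?_
    exact Primrec.beq.comp (primrec_tableRun (Primrec.snd.comp (Primrec.fst.comp Primrec.fst))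
      Primrec.snd (Primrec.snd.comp Primrec.fst)) (Primrec.snd.comp Primrec.fst)
  · exact Primrec.beq.comp (primrec_tableRun (Primrec.snd.comp Primrec.fst)
      (hw.comp (Primrec.fst.comp Primrec.fst)) Primrec.snd) Primrec.snd

end

end Membership

/-! ### Short words -/

section Short

variable {X : Type*}

/-- Walks can be shortened, simultaneously for a family of starting points. -/
theorem exists_short_of_staysIn {H : Subgroup (FreeGroup X)} {V : Set (RightCosets H)}
    (hV : V.Finite) {ι : Type*} [Fintype ι] (a : ι → RightCosets H) (L : List (Letter X))
    (hL : ∀ i, StaysIn V (a i) L) :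
    ∃ M : List (Letter X), M.length ≤ V.ncard ^ Fintype.card ι ∧
      ∀ i, move (a i) (FreeGroup.mk M) = move (a i) (FreeGroup.mk L) := by
  classical
  induction hn : L.length using Nat.strong_induction_on generalizing L with
  | _ m ih =>
    subst hn
    by_cases hlen : L.length ≤ V.ncard ^ Fintype.card ι
    · exact ⟨L, hlen, fun _ => rfl⟩
    have : Fintype V := hV.fintype
    -- Pigeonhole: `f` records the tuple of vertices reached after each prefix. If two prefixes give
    -- the same tuple, the factor between them can be cut out.
    let f : Fin (L.length + 1) → ι → V := fun j i =>
      ⟨move (a i) (FreeGroup.mk (L.take j)), hL i _ (List.take_prefix _ _)⟩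
    have hcard : Fintype.card (ι → V) < Fintype.card (Fin (L.length + 1)) := by
      rw [Fintype.card_fun, Fintype.card_fin, ← Nat.card_eq_fintype_card (α := V),
        Nat.card_coe_set_eq]
      omega
    obtain ⟨x, y, hxy, hf⟩ := Fintype.exists_ne_map_eq_of_card_lt f hcard
    obtain ⟨j, j', hlt, hf⟩ : ∃ j j' : Fin (L.length + 1), j < j' ∧ f j = f j' := by
      rcases lt_or_gt_of_ne hxy with h | h
      · exact ⟨x, y, h, hf⟩
      · exact ⟨y, x, h, hf.symm⟩
    have hf' : ∀ i, move (a i) (FreeGroup.mk (L.take j)) = move (a i) (FreeGroup.mk (L.take j')) :=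
      fun i => congrArg Subtype.val (congrFun hf i)
    have hstay : ∀ i, StaysIn V (a i) (L.take j ++ L.drop j') := fun i => by
      refine ((hL i).of_prefix (List.take_prefix _ _)).append ?_
      rw [hf' i]
      exact StaysIn.of_append (by rw [List.take_append_drop]; exact hL i)
    have hlt' : (j : ℕ) < j' := hlt
    have hj' := j'.2
    obtain ⟨M, hM, hMm⟩ := ih _ (by
      rw [List.length_append, List.length_take, List.length_drop]; omega) _ hstay rfl
    refine ⟨M, hM, fun i => ?_⟩
    rw [hMm, ← FreeGroup.mul_mk, move_mul, hf', ← move_mul, FreeGroup.mul_mk,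
      List.take_append_drop]

theorem exists_short_word [DecidableEq X] {S : List (List (Letter X))} {u : List (Letter X)}
    {ι : Type*} [Fintype ι] {a b : ι → RightCosets (spanWords S)} {w : FreeGroup X}
    (ha : ∀ i, a i ∈ tracedVerts S u) (hb : ∀ i, b i ∈ tracedVerts S u)
    (hw : ∀ i, move (a i) w = b i) :
    ∃ M : List (Letter X), M.length ≤ (prefixList S u).length ^ Fintype.card ι ∧
      ∀ i, move (a i) (FreeGroup.mk M) = b i := by
  obtain ⟨M, hM, h⟩ := exists_short_of_staysIn finite_tracedVerts a w.toWord
    fun i => staysIn_toWord (ha i) (hb i) (hw i)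
  refine ⟨M, hM.trans (Nat.pow_le_pow_left ncard_tracedVerts_le _), fun i => ?_⟩
  rw [h, FreeGroup.mk_toWord, hw]

end Short

/-! ### Orbit cosets -/

section OrbitCosets

variable {X : Type*} {H : Subgroup (FreeGroup X)} {k : ℕ}

/-- Lying in the coset means moving `H w^j` to `H w^(j+1)` for `j < k`, and induction turns this
into equality of the two sequences of cosets. The condition is an equivalence relation, so orbit
cosets are equal or disjoint. -/
theorem mem_orbitCoset_iff {g w : FreeGroup X} : g ∈ orbitCoset H k w ↔
    ∀ j ≤ k, cosetVertex H (g ^ j) = cosetVertex H (w ^ j) := by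
  have h₁ : g ∈ orbitCoset H k w ↔
      ∀ j < k, move (cosetVertex H (w ^ j)) g = cosetVertex H (w ^ (j + 1)) := by
    have : g ∈ orbitCoset H k w ↔ g * w⁻¹ ∈ (⨅ j : Fin k, conjSubgroup H (w ^ (j : ℕ))) := by
      constructor
      · rintro ⟨h, hh, rfl⟩; simpa using hh
      · intro h; exact ⟨_, h, by group⟩
    rw [this, Subgroup.mem_iInf, Fin.forall_iff]
    refine forall₂_congr fun j _ => ?_
    rw [mem_conjSubgroup_iff_move, move_mul, move_eq_iff, inv_inv, move_cosetVertex (w ^ j) w,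
      pow_succ]
  rw [h₁]
  constructor
  · intro h j
    induction j with
    | zero => simp
    | succ j ih =>
      intro hj
      rw [pow_succ, ← move_cosetVertex, ih (by omega), h j hj]
  · intro h j hj
    rw [← h j hj.le, move_cosetVertex, ← pow_succ, h (j + 1) hj]

theorem mem_orbitCoset_self (w : FreeGroup X) : w ∈ orbitCoset H k w :=
  mem_orbitCoset_iff.mpr fun _ _ => rfl

theorem mem_preorderSet_of_powers_eq (hk : 1 ≤ k) {u y z h : FreeGroup X}
    (hu : move (cosetVertex H u) h = cosetVertex H u)
    (hyz : ∀ j ≤ k, cosetVertex H (y ^ j) = move (cosetVertex H (z ^ j)) h)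
    (hz : z ∈ preorderSet (rCoset H u) k) : y ∈ preorderSet (rCoset H u) k := by
  rw [mem_preorderSet_rCoset_iff hk] at hz ⊢
  have h' : (fun i : Fin (k + 1) => cosetVertex H (y ^ (i : ℕ))) =
      fun i : Fin (k + 1) => move (cosetVertex H (z ^ (i : ℕ))) h :=
    funext fun i => hyz i (Nat.lt_succ_iff.mp i.2)
  rw [h', hyz k le_rfl, hz.2, hu]
  exact ⟨(nearlyInjective_comp_iff (move_injective h)).mpr hz.1, rfl⟩

theorem conj_pow_inv (h y : FreeGroup X) (j : ℕ) : (h⁻¹ * y * h) ^ j = h⁻¹ * y ^ j * h := by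
  simpa using conj_pow (a := h⁻¹) (b := y) (i := j)

theorem conjSet_orbitCoset_subset (hk : 1 ≤ k) {u w z : FreeGroup X}
    (hw : w ∈ preorderSet (rCoset H u) k)
    (hz : z ∈ conjSet (orbitCoset H k w) ((H ⊓ conjSubgroup H u : Subgroup (FreeGroup X)) :
      Set (FreeGroup X))) : z ∈ preorderSet (rCoset H u) k := by
  obtain ⟨y, hy, h, ⟨hh, hhu⟩, rfl⟩ := hz
  rw [mem_orbitCoset_iff] at hy
  refine mem_preorderSet_of_powers_eq hk (mem_conjSubgroup_iff_move.mp hhu) (fun j hj => ?_) hw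
  rw [← hy j hj, conj_pow_inv, move_cosetVertex, cosetVertex_eq_iff]
  convert (show h ∈ H from hh) using 1
  group

/-- Every element of order `k` is, up to conjugation, in the orbit coset of a short one. -/
theorem exists_short_orbit_rep [DecidableEq X] {S : List (List (Letter X))} {u : List (Letter X)}
    (hk : 1 ≤ k) {z : FreeGroup X}
    (hz : z ∈ preorderSet (rCoset (spanWords S) (FreeGroup.mk u)) k) :
    ∃ w : List (Letter X), w.length ≤ 3 * (prefixList S u).length ^ (k + 1) ∧
      FreeGroup.mk w ∈ preorderSet (rCoset (spanWords S) (FreeGroup.mk u)) k ∧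
      z ∈ conjSet (orbitCoset (spanWords S) k (FreeGroup.mk w))
        ((spanWords S ⊓ conjSubgroup (spanWords S) (FreeGroup.mk u) : Subgroup (FreeGroup X)) :
          Set (FreeGroup X)) := by
  have hz' := (mem_preorderSet_rCoset_iff hk).mp hz
  obtain ⟨c, hc⟩ := exists_move_mem_cosetStallings hk hz'.2
  replace hc := fun i hi => cosetStallings_verts_subset (hc i hi)
  -- `D` is a short substitute for `c⁻¹ z c`: it makes all `k` steps of the translated trail at
  -- once.
  obtain ⟨D, hDlen, hD⟩ := exists_short_word (S := S) (u := u) (ι := Fin k)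
    (a := fun i => cosetVertex _ (z ^ (i : ℕ) * c))
    (b := fun i => cosetVertex _ (z ^ ((i : ℕ) + 1) * c)) (w := c⁻¹ * z * c)
    (fun i => hc i i.2.le) (fun i => hc _ i.2) (fun i => by
      rw [move_cosetVertex, pow_succ]; congr 1; group)
  -- `E` is a short substitute for `c⁻¹`: it carries both ends of the translated trail back, to `H`
  -- and to `Hu`. Hence `c E` lies in `H ∩ H^u`.
  obtain ⟨E, hElen, hE⟩ := exists_short_word (S := S) (u := u) (ι := Bool)
    (a := fun i => if i then cosetVertex _ c else cosetVertex _ (z ^ k * c))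
    (b := fun i => if i then cosetVertex _ 1 else cosetVertex _ (FreeGroup.mk u)) (w := c⁻¹)
    (fun i => by cases i <;> simp [hc k le_rfl]; simpa using hc 0 (Nat.zero_le k))
    (fun i => by cases i <;> simp [base_mem_tracedVerts, target_mem_tracedVerts])
    (fun i => by cases i <;> simp [hz'.2])
  have hE₀ := hE true
  have hE₁ := hE false
  simp only [if_true, Bool.false_eq_true, if_false] at hE₀ hE₁
  have hpos : 1 ≤ (prefixList S u).length :=
    List.length_pos_of_mem nil_mem_prefixList
  have hDp : ∀ j ≤ k, move (cosetVertex (spanWords S) c) (FreeGroup.mk D ^ j) =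
      cosetVertex (spanWords S) (z ^ j * c) := by
    intro j
    induction j with
    | zero => simp
    | succ j ih =>
      intro hj
      rw [pow_succ, move_mul, ih (by omega)]
      exact hD ⟨j, hj⟩
  have hbase : cosetVertex (spanWords S) (FreeGroup.mk E)⁻¹ = cosetVertex (spanWords S) c := by
    rw [move_eq_iff.mp hE₀, move_cosetVertex, one_mul]
  have hw : FreeGroup.mk (FreeGroup.invRev E ++ D ++ E) =
      (FreeGroup.mk E)⁻¹ * FreeGroup.mk D * FreeGroup.mk E := by
    rw [← FreeGroup.mul_mk, ← FreeGroup.mul_mk, FreeGroup.inv_mk]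
  have hpow : ∀ j ≤ k, cosetVertex (spanWords S) (FreeGroup.mk (FreeGroup.invRev E ++ D ++ E) ^ j)
      = move (cosetVertex (spanWords S) (z ^ j)) (c * FreeGroup.mk E) := by
    intro j hj
    rw [hw, conj_pow_inv, ← move_cosetVertex, ← move_cosetVertex, hbase, hDp j hj,
      move_cosetVertex, move_cosetVertex, mul_assoc]
  have hcu : move (cosetVertex (spanWords S) (FreeGroup.mk u)) (c * FreeGroup.mk E) =
      cosetVertex (spanWords S) (FreeGroup.mk u) := by
    rw [← hz'.2, move_cosetVertex, ← mul_assoc, ← move_cosetVertex, hE₁, hz'.2]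
  have hcH : c * FreeGroup.mk E ∈ spanWords S := by
    rw [← cosetVertex_eq_base_iff, ← move_cosetVertex, hE₀]
  -- With `N` prefixes, `D` has length at most `N^k` and `E` at most `N^2`. Both are at most
  -- `N^(k+1)` as `k ≥ 1`, whence the factor `3`.
  refine ⟨FreeGroup.invRev E ++ D ++ E, ?_, ?_, ?_⟩
  · have h₁ : (prefixList S u).length ^ Fintype.card (Fin k) ≤ (prefixList S u).length ^ (k + 1) :=
      Nat.pow_le_pow_right hpos (by simp)
    have h₂ : (prefixList S u).length ^ Fintype.card Bool ≤ (prefixList S u).length ^ (k + 1) :=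
      Nat.pow_le_pow_right hpos (by simp; omega)
    simp only [List.length_append, FreeGroup.invRev_length]
    omega
  · exact mem_preorderSet_of_powers_eq hk hcu hpow hz
  · refine ⟨(c * FreeGroup.mk E)⁻¹ * z * (c * FreeGroup.mk E), ?_, (c * FreeGroup.mk E)⁻¹,
      Subgroup.inv_mem _ ⟨hcH, mem_conjSubgroup_iff_move.mpr hcu⟩, by group⟩
    rw [mem_orbitCoset_iff]
    intro j hj
    rw [hpow j hj, conj_pow_inv, move_cosetVertex, cosetVertex_eq_iff]
    convert hcH using 1
    group

end OrbitCosets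

/-! ### Greedy selection -/

section Greedy

variable {β : Type*}

/-- Add `w` unless a related element is already there. -/
def addNew (r : β → β → Bool) (acc : List β) (w : β) : List β :=
  bif acc.any (fun v => r v w) then acc else w :: acc

/-- Add successively the elements of a list that are not related to one already there. -/
def greedy (r : β → β → Bool) (acc L : List β) : List β :=
  L.foldl (addNew r) acc

variable {r : β → β → Bool} {acc L : List β}

theorem subset_addNew (w : β) : acc ⊆ addNew r acc w := by
  unfold addNew
  cases acc.any fun v => r v w <;> simp

theorem subset_greedy : acc ⊆ greedy r acc L := by
  induction L generalizing acc with
  | nil => exact List.Subset.refl _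
  | cons w L ih => exact List.Subset.trans (subset_addNew w) ih

/-- An invariant need only be checked when a candidate is added. The inclusion `acc ⊆ l` lets the
check use that the elements present initially are still there. -/
theorem greedy_induction {P : List β → Prop} (hacc : P acc)
    (hadd : ∀ l, ∀ w ∈ L, acc ⊆ l → P l → (∀ v ∈ l, r v w = false) → P (w :: l)) :
    P (greedy r acc L) := by
  induction L generalizing acc with
  | nil => exact hacc
  | cons w L ih =>
    refine ih (acc := addNew r acc w) ?_ fun l v hv hl =>
      hadd l v (by simp [hv]) (List.Subset.trans (subset_addNew w) hl)
    unfold addNew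
    cases hany : acc.any fun v => r v w
    · exact hadd acc w (by simp) (List.Subset.refl _) hacc (by simpa using hany)
    · exact hacc

theorem exists_mem_greedy (hr : ∀ w, r w w = true) {w : β} (hw : w ∈ L) :
    ∃ v ∈ greedy r acc L, r v w = true := by
  induction L generalizing acc with
  | nil => simp at hw
  | cons x L ih =>
    rcases List.mem_cons.mp hw with rfl | hw
    · have : ∃ v ∈ addNew r acc w, r v w = true := by
        unfold addNew
        cases hany : acc.any fun v => r v w
        · exact ⟨w, by simp, hr w⟩
        · simpa using hany
      obtain ⟨v, hv, hvw⟩ := this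
      exact ⟨v, subset_greedy (L := L) hv, hvw⟩
    · exact ih hw

theorem mem_of_mem_greedy {v : β} (h : v ∈ greedy r acc L) : v ∈ acc ∨ v ∈ L := by
  revert v
  refine greedy_induction (P := fun l => ∀ {v}, v ∈ l → v ∈ acc ∨ v ∈ L) (fun h => Or.inl h) ?_
  intro l w hw _ hl _ v hv
  rcases List.mem_cons.mp hv with rfl | hv
  · exact Or.inr hw
  · exact hl hv

theorem pairwise_greedy (hacc : acc.Pairwise fun v w => r w v = false) :
    (greedy r acc L).Pairwise fun v w => r w v = false :=
  greedy_induction (P := fun l => l.Pairwise fun v w => r w v = false) hacc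
    fun _ _ _ _ hl hw => List.pairwise_cons.mpr ⟨hw, hl⟩

theorem primrec_greedy {α : Type*} [Primcodable α] [Primcodable β] {r : α → β → β → Bool}
    {acc L : α → List β} (hr : Primrec fun x : α × β × β => r x.1 x.2.1 x.2.2)
    (hacc : Primrec acc) (hL : Primrec L) : Primrec fun x => greedy (r x) (acc x) (L x) := by
  refine Primrec.list_foldl (h := fun x p => addNew (r x) p.1 p.2) hL hacc ?_
  refine Primrec.cond (c := fun p : α × List β × β => p.2.1.any fun v => r p.1 v p.2.2)
    (Primrec.list_any (Primrec.fst.comp Primrec.snd) ?_) (Primrec.fst.comp Primrec.snd)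
    (Primrec.list_cons.comp (Primrec.snd.comp Primrec.snd) (Primrec.fst.comp Primrec.snd))
  exact hr.comp (Primrec.pair (Primrec.fst.comp Primrec.fst)
    (Primrec.pair Primrec.snd (Primrec.snd.comp (Primrec.snd.comp Primrec.fst))))

end Greedy

/-! ### The search for representatives -/

section Search

variable {n : ℕ}

/-- Decides whether `w` and `u` represent the same right coset. -/
noncomputable def sameCoset (S : List (List (Letter (Fin n)))) (w u : List (Letter (Fin n))) :
    Bool :=
  memSpan S (w ++ FreeGroup.invRev u)

/-- The word `w ^ j`. -/
def wordPow {X : Type*} (w : List (Letter X)) (j : ℕ) : List (Letter X) :=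
  (List.replicate j w).flatten

/-- Decides whether `w` has order `k` in the right coset of `u`. -/
noncomputable def hasOrder (S : List (List (Letter (Fin n)))) (u : List (Letter (Fin n))) (k : ℕ)
    (w : List (Letter (Fin n))) : Bool :=
  sameCoset S (wordPow w k) u &&
    (List.range k).all fun j => j == 0 || !sameCoset S (wordPow w j) u

/-- Decides whether `v` and `w` have the same orbit coset. -/
noncomputable def sameOrbit (S : List (List (Letter (Fin n)))) (k : ℕ)
    (v w : List (Letter (Fin n))) : Bool :=
  (List.range (k + 1)).all fun j => sameCoset S (wordPow v j) (wordPow w j)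

/-- The words of length at most `N`. -/
noncomputable def wordsUpTo (n N : ℕ) : List (List (Letter (Fin n))) :=
  (List.range (N + 1)).flatMap (allLists (letters n))

/-- Representatives of the orbit cosets of the short elements of order `k`. -/
noncomputable def orbitReps (S : List (List (Letter (Fin n)))) (u : List (Letter (Fin n)))
    (k : ℕ) : List (List (Letter (Fin n))) :=
  greedy (sameOrbit S k) []
    ((wordsUpTo n (3 * (prefixList S u).length ^ (k + 1))).filter (hasOrder S u k))

variable {S : List (List (Letter (Fin n)))} {u v w : List (Letter (Fin n))} {k : ℕ}

theorem sameCoset_iff : sameCoset S w u = true ↔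
    cosetVertex (spanWords S) (FreeGroup.mk w) = cosetVertex (spanWords S) (FreeGroup.mk u) := by
  unfold sameCoset
  rw [memSpan_iff, ← FreeGroup.mul_mk, ← FreeGroup.inv_mk, eq_comm, cosetVertex_eq_iff]

theorem mk_wordPow (j : ℕ) : FreeGroup.mk (wordPow w j) = FreeGroup.mk w ^ j :=
  (FreeGroup.pow_mk j).symm

theorem hasOrder_iff (hk : 1 ≤ k) : hasOrder S u k w = true ↔
    FreeGroup.mk w ∈ preorderSet (rCoset (spanWords S) (FreeGroup.mk u)) k := by
  rw [mem_preorderSet_iff hk]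
  unfold hasOrder
  simp only [Bool.and_eq_true, sameCoset_iff, mk_wordPow, mem_rCoset_iff, List.all_eq_true,
    List.mem_range, Bool.or_eq_true, beq_iff_eq, Bool.not_eq_true', ← Bool.not_eq_true]
  refine and_congr_right fun _ => forall_congr' fun j => ?_
  constructor
  · intro h hj hjk
    exact (h hjk).resolve_left (by omega)
  · intro h hjk
    by_cases hj : j = 0
    · exact Or.inl hj
    · exact Or.inr (h (by omega) hjk)

theorem sameOrbit_iff : sameOrbit S k v w = true ↔
    FreeGroup.mk v ∈ orbitCoset (spanWords S) k (FreeGroup.mk w) := by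
  rw [mem_orbitCoset_iff]
  unfold sameOrbit
  simp only [List.all_eq_true, List.mem_range, sameCoset_iff, mk_wordPow, Nat.lt_succ_iff]

theorem mem_wordsUpTo {N : ℕ} : w ∈ wordsUpTo n N ↔ w.length ≤ N := by
  unfold wordsUpTo
  simp [List.mem_flatMap, mem_allLists, mem_letters]

theorem hasOrder_of_mem_orbitReps (h : w ∈ orbitReps S u k) : hasOrder S u k w = true := by
  rcases mem_of_mem_greedy h with h | h
  · simp at h
  · exact (List.mem_filter.mp h).2

theorem pairwise_orbitReps : (orbitReps S u k).Pairwise fun w w' =>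
    Disjoint (orbitCoset (spanWords S) k (FreeGroup.mk w))
      (orbitCoset (spanWords S) k (FreeGroup.mk w')) := by
  refine (pairwise_greedy List.Pairwise.nil).imp fun {v w} h => ?_
  rw [Set.disjoint_left]
  intro x hx hx'
  rw [← Bool.not_eq_true, sameOrbit_iff, mem_orbitCoset_iff] at h
  rw [mem_orbitCoset_iff] at hx hx'
  exact h fun j hj => (hx' j hj).symm.trans (hx j hj)

theorem preorderSet_eq_conjSet_orbitReps (hk : 1 ≤ k) :
    preorderSet (rCoset (spanWords S) (FreeGroup.mk u)) k =
      conjSet (⋃ w ∈ orbitReps S u k, orbitCoset (spanWords S) k (FreeGroup.mk w))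
        ((spanWords S ⊓ conjSubgroup (spanWords S) (FreeGroup.mk u) :
          Subgroup (FreeGroup (Fin n))) : Set (FreeGroup (Fin n))) := by
  ext z
  constructor
  · intro hz
    obtain ⟨w, hlen, hw, y, hy, h, hh, rfl⟩ := exists_short_orbit_rep hk hz
    obtain ⟨v, hv, hvw⟩ := exists_mem_greedy (r := sameOrbit S k) (acc := [])
      (fun w => sameOrbit_iff.mpr (mem_orbitCoset_self _))
      (List.mem_filter.mpr ⟨mem_wordsUpTo.mpr hlen, (hasOrder_iff hk).mpr hw⟩)
    refine ⟨y, ?_, h, hh, rfl⟩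
    simp only [Set.mem_iUnion, exists_prop]
    refine ⟨v, hv, ?_⟩
    rw [sameOrbit_iff, mem_orbitCoset_iff] at hvw
    rw [mem_orbitCoset_iff] at hy ⊢
    exact fun j hj => (hy j hj).trans (hvw j hj).symm
  · rintro ⟨y, hy, h, hh, rfl⟩
    simp only [Set.mem_iUnion, exists_prop] at hy
    obtain ⟨w, hw, hy⟩ := hy
    exact conjSet_orbitCoset_subset hk ((hasOrder_iff hk).mp (hasOrder_of_mem_orbitReps hw))
      ⟨y, hy, h, hh, rfl⟩

/-! ### Primitive recursiveness of the search -/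

section

variable {α : Type*} [Primcodable α]

theorem primrec_invRev : Primrec (FreeGroup.invRev : List (Letter (Fin n)) → _) :=
  Primrec.list_reverse.comp (Primrec.list_map Primrec.id
    (Primrec.pair (Primrec.fst.comp Primrec.snd) (Primrec.not.comp (Primrec.snd.comp Primrec.snd))))

theorem primrec_sameCoset {S : α → List (List (Letter (Fin n)))} {w u : α → List (Letter (Fin n))}
    (hS : Primrec S) (hw : Primrec w) (hu : Primrec u) :
    Primrec fun x => sameCoset (S x) (w x) (u x) :=
  primrec_memSpan hS (Primrec.list_append.comp hw (primrec_invRev.comp hu))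

theorem primrec_wordPow {w : α → List (Letter (Fin n))} {j : α → ℕ} (hw : Primrec w)
    (hj : Primrec j) : Primrec fun x => wordPow (w x) (j x) := by
  refine (Primrec.list_flatMap (Primrec.list_range.comp hj) (g := fun x _ => w x)
    (hw.comp Primrec.fst)).of_eq fun x => ?_
  unfold wordPow
  rw [List.flatMap_def]
  congr 1
  simp

theorem primrec_hasOrder {S : α → List (List (Letter (Fin n)))} {u w : α → List (Letter (Fin n))}
    {k : α → ℕ} (hS : Primrec S) (hu : Primrec u) (hk : Primrec k) (hw : Primrec w) :
    Primrec fun x => hasOrder (S x) (u x) (k x) (w x) := by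
  refine Primrec.and.comp (primrec_sameCoset hS (primrec_wordPow hw hk) hu) ?_
  refine Primrec.list_all (Primrec.list_range.comp hk) ?_
  refine Primrec.or.comp (Primrec.beq.comp Primrec.snd (Primrec.const 0)) (Primrec.not.comp ?_)
  exact primrec_sameCoset (hS.comp Primrec.fst)
    (primrec_wordPow (hw.comp Primrec.fst) Primrec.snd) (hu.comp Primrec.fst)

theorem primrec_sameOrbit {S : α → List (List (Letter (Fin n)))} {v w : α → List (Letter (Fin n))}
    {k : α → ℕ} (hS : Primrec S) (hk : Primrec k) (hv : Primrec v) (hw : Primrec w) :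
    Primrec fun x => sameOrbit (S x) (k x) (v x) (w x) := by
  refine Primrec.list_all (Primrec.list_range.comp (Primrec.succ.comp hk)) ?_
  exact primrec_sameCoset (hS.comp Primrec.fst) (primrec_wordPow (hv.comp Primrec.fst) Primrec.snd)
    (primrec_wordPow (hw.comp Primrec.fst) Primrec.snd)

theorem primrec_wordsUpTo : Primrec (wordsUpTo n) :=
  Primrec.list_flatMap (Primrec.list_range.comp Primrec.succ)
    (primrec_allLists.comp (Primrec.const _) Primrec.snd)

theorem primrec_natPow {f g : α → ℕ} (hf : Primrec f) (hg : Primrec g) :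
    Primrec fun x => f x ^ g x :=
  (Primrec₂.unpaired'.mp Nat.Primrec.pow).comp hf hg

theorem primrec_orbitReps {S : α → List (List (Letter (Fin n)))} {u : α → List (Letter (Fin n))}
    {k : α → ℕ} (hS : Primrec S) (hu : Primrec u) (hk : Primrec k) :
    Primrec fun x => orbitReps (S x) (u x) (k x) := by
  refine primrec_greedy (r := fun x => sameOrbit (S x) (k x))
    (primrec_sameOrbit (hS.comp Primrec.fst) (hk.comp Primrec.fst)
      (Primrec.fst.comp Primrec.snd) (Primrec.snd.comp Primrec.snd)) (Primrec.const []) ?_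
  refine Primrec.list_filter_param (primrec_wordsUpTo.comp (Primrec.nat_mul.comp (Primrec.const 3)
    (primrec_natPow (Primrec.list_length.comp (primrec_prefixList.comp hS hu))
      (Primrec.succ.comp hk)))) ?_
  exact primrec_hasOrder (hS.comp Primrec.fst) (hu.comp Primrec.fst) (hk.comp Primrec.fst)
    Primrec.snd

end

end Search

/-! ### Free bases from prefix-closed transversals -/

section Words

variable {X : Type*}

/-- The inverse letter. -/
def invLetter (a : Letter X) : Letter X := (a.1, !a.2)

@[simp] theorem invLetter_invLetter (a : Letter X) : invLetter (invLetter a) = a := by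
  simp [invLetter]

theorem mk_invLetter (a : Letter X) : FreeGroup.mk [invLetter a] = (FreeGroup.mk [a])⁻¹ := by
  simp [FreeGroup.inv_mk, FreeGroup.invRev, invLetter]

theorem invRev_cons (a : Letter X) (L : List (Letter X)) :
    FreeGroup.invRev (a :: L) = FreeGroup.invRev L ++ [invLetter a] := by
  simp [FreeGroup.invRev, invLetter]

theorem invRev_concat (a : Letter X) (L : List (Letter X)) :
    FreeGroup.invRev (L ++ [a]) = invLetter a :: FreeGroup.invRev L := by
  simp [FreeGroup.invRev, invLetter]

theorem isReduced_pair_iff {a b : Letter X} :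
    FreeGroup.IsReduced [a, b] ↔ b ≠ invLetter a := by
  obtain ⟨x, s⟩ := a
  obtain ⟨y, t⟩ := b
  rw [FreeGroup.isReduced_cons_cons]
  cases s <;> cases t <;> simp [invLetter, eq_comm]

theorem isReduced_cons_of {a : Letter X} {L : List (Letter X)} (hL : FreeGroup.IsReduced L)
    (h : L.head? ≠ some (invLetter a)) : FreeGroup.IsReduced (a :: L) := by
  cases L with
  | nil => simp
  | cons b L =>
    refine FreeGroup.IsReduced.append_overlap (L₁ := [a]) (L₂ := [b]) ?_ hL (by simp)
    exact isReduced_pair_iff.mpr fun hb => h (by simp [hb])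

theorem isReduced_concat_iff {a : Letter X} {L : List (Letter X)} :
    FreeGroup.IsReduced (L ++ [a]) ↔
      FreeGroup.IsReduced L ∧ ∀ M, L ≠ M ++ [invLetter a] := by
  constructor
  · intro h
    refine ⟨h.infix ⟨[], [a], by simp⟩, ?_⟩
    rintro M rfl
    have : FreeGroup.IsReduced [invLetter a, a] := h.infix ⟨M, [], by simp⟩
    exact isReduced_pair_iff.mp this (by simp)
  · rintro ⟨hL, h⟩
    rcases List.eq_nil_or_concat L with rfl | ⟨M, b, rfl⟩
    · simp
    · rw [List.concat_eq_append] at hL h ⊢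
      refine FreeGroup.IsReduced.append_overlap hL (L₃ := [a]) ?_ (by simp)
      refine isReduced_pair_iff.mpr fun hab => ?_
      subst hab
      exact h M (by simp)

variable [DecidableEq X]

theorem isReduced_invRev {L : List (Letter X)} (hL : FreeGroup.IsReduced L) :
    FreeGroup.IsReduced (FreeGroup.invRev L) := by
  rw [FreeGroup.isReduced_iff_reduce_eq, FreeGroup.reduce_invRev, hL.reduce_eq]

theorem toWord_mk_of_isReduced {L : List (Letter X)} (hL : FreeGroup.IsReduced L) :
    (FreeGroup.mk L).toWord = L := by
  rw [FreeGroup.toWord_mk, hL.reduce_eq]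

/-- If `o l` is reduced and is not a prefix of `G`, then `o⁻¹ G` does not start with `l`. -/
theorem head_toWord_ne {o G : List (Letter X)} {l : Letter X}
    (ho : FreeGroup.IsReduced (o ++ [l])) (hG : FreeGroup.IsReduced G) (hp : ¬ o ++ [l] <+: G) :
    ((FreeGroup.mk o)⁻¹ * FreeGroup.mk G).toWord.head? ≠ some l := by
  induction o generalizing G with
  | nil =>
    intro h
    rw [← FreeGroup.one_eq_mk, inv_one, one_mul, toWord_mk_of_isReduced hG] at h
    cases G with
    | nil => simp at h
    | cons c G => apply hp; simp_all
  | cons c o ih =>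
    have ho' : FreeGroup.IsReduced (o ++ [l]) := ho.infix ⟨[c], [], by simp⟩
    by_cases hc : ∃ G', G = c :: G'
    · obtain ⟨G', rfl⟩ := hc
      -- A common first letter cancels in `o⁻¹ G`.
      have := ih (G := G') ho' (hG.infix ⟨[c], [], by simp⟩) (fun h => hp (by simpa using h))
      rwa [mk_cons, mk_cons c G', mul_inv_rev, mul_assoc, inv_mul_cancel_left]
    · have hcG : FreeGroup.IsReduced (invLetter c :: G) := by
        refine isReduced_cons_of hG fun h => hc ?_
        cases G with
        | nil => simp at h
        | cons d G => exact ⟨G, by simp_all⟩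
      have hco : FreeGroup.IsReduced (c :: o) := ho.infix ⟨[], [l], by simp⟩
      -- Without a common first letter nothing cancels, so the word starts with the inverse of the
      -- last letter of `o`. That is not `l`, because `o l` is reduced.
      have hred : FreeGroup.IsReduced (FreeGroup.invRev (c :: o) ++ G) := by
        have h₁ := isReduced_invRev hco
        rw [invRev_cons] at h₁ ⊢
        exact h₁.append_overlap hcG (by simp)
      rw [FreeGroup.inv_mk, FreeGroup.mul_mk, toWord_mk_of_isReduced hred]
      obtain ⟨M, d, hM⟩ := (List.eq_nil_or_concat (c :: o)).resolve_left (by simp)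
      rw [List.concat_eq_append] at hM
      rw [hM, invRev_concat]
      intro h
      have hd : invLetter d = l := by simpa using h
      rw [hM] at ho
      refine (isReduced_concat_iff.mp ho).2 M ?_
      rw [← hd, invLetter_invLetter]

/-- If `s l` and `o l⁻¹` are reduced and the latter is not a prefix of `g`, then `s l` is a prefix
of `s l o⁻¹ g`. -/
theorem prefix_toWord_mul {s o : List (Letter X)} {l : Letter X} {g : FreeGroup X}
    (hs : FreeGroup.IsReduced (s ++ [l])) (ho : FreeGroup.IsReduced (o ++ [invLetter l]))
    (hp : ¬ o ++ [invLetter l] <+: g.toWord) :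
    s ++ [l] <+: (FreeGroup.mk (s ++ [l]) * (FreeGroup.mk o)⁻¹ * g).toWord := by
  have hh := head_toWord_ne ho FreeGroup.isReduced_toWord hp
  rw [FreeGroup.mk_toWord] at hh
  have hred : FreeGroup.IsReduced (s ++ [l] ++ ((FreeGroup.mk o)⁻¹ * g).toWord) :=
    hs.append_overlap (isReduced_cons_of FreeGroup.isReduced_toWord hh) (by simp)
  have : FreeGroup.mk (s ++ [l]) * (FreeGroup.mk o)⁻¹ * g =
      FreeGroup.mk (s ++ [l] ++ ((FreeGroup.mk o)⁻¹ * g).toWord) := by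
    rw [← FreeGroup.mul_mk (L₂ := FreeGroup.toWord _), FreeGroup.mk_toWord, mul_assoc]
  rw [this, toWord_mk_of_isReduced hred]
  exact List.prefix_append _ _

end Words

/-! ### Coset trees and their chords -/

section Trees

variable {X : Type*}

/-- A prefix-closed set of words that represent different right cosets of `K`. -/
structure IsCosetTree (K : Subgroup (FreeGroup X)) (Tr : Set (List (Letter X))) : Prop where
  nil_mem : [] ∈ Tr
  of_concat : ∀ t a, t ++ [a] ∈ Tr → t ∈ Tr
  eq_of_mem : ∀ s ∈ Tr, ∀ t ∈ Tr, FreeGroup.mk s * (FreeGroup.mk t)⁻¹ ∈ K → s = t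

/-- The words `t` and `t'` of the tree are joined by an arc with label `x` outside the tree. -/
structure IsTreeChord (K : Subgroup (FreeGroup X)) (Tr : Set (List (Letter X)))
    (e : List (Letter X) × X × List (Letter X)) : Prop where
  fst_mem : e.1 ∈ Tr
  snd_mem : e.2.2 ∈ Tr
  mem : FreeGroup.mk (e.1 ++ [(e.2.1, true)]) * (FreeGroup.mk e.2.2)⁻¹ ∈ K
  ne_fst : e.1 ++ [(e.2.1, true)] ≠ e.2.2
  ne_snd : e.2.2 ++ [(e.2.1, false)] ≠ e.1

/-- The generator that belongs to a chord. -/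
def chordWord (e : List (Letter X) × X × List (Letter X)) : List (Letter X) :=
  e.1 ++ [(e.2.1, true)] ++ FreeGroup.invRev e.2.2

theorem mk_chordWord (e : List (Letter X) × X × List (Letter X)) :
    FreeGroup.mk (chordWord e) =
      FreeGroup.mk (e.1 ++ [(e.2.1, true)]) * (FreeGroup.mk e.2.2)⁻¹ := by
  rw [chordWord, ← FreeGroup.mul_mk, FreeGroup.inv_mk]

variable {K : Subgroup (FreeGroup X)} {Tr : Set (List (Letter X))}

theorem IsCosetTree.of_prefix (hT : IsCosetTree K Tr) {s t : List (Letter X)} (h : s <+: t)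
    (ht : t ∈ Tr) : s ∈ Tr := by
  obtain ⟨r, rfl⟩ := h
  induction r using List.reverseRecOn with
  | nil => simpa using ht
  | append_singleton r a ih =>
    rw [← List.append_assoc] at ht
    exact ih (hT.of_concat _ _ ht)

theorem IsCosetTree.isReduced (hT : IsCosetTree K Tr) {t : List (Letter X)} (ht : t ∈ Tr) :
    FreeGroup.IsReduced t := by
  induction t using List.reverseRecOn with
  | nil => simp
  | append_singleton t a ih =>
    have ht' := hT.of_concat t a ht
    refine isReduced_concat_iff.mpr ⟨ih ht', ?_⟩
    rintro M rfl
    have hM := hT.of_concat _ _ ht'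
    have := hT.eq_of_mem _ ht _ hM (by
      rw [← FreeGroup.mul_mk, ← FreeGroup.mul_mk, mk_invLetter, inv_mul_cancel_right,
        mul_inv_cancel]
      exact K.one_mem)
    have := congrArg List.length this
    simp at this

section Chords

variable {ι : Type*} {e : ι → List (Letter X) × X × List (Letter X)}

/-- The origin of a chord, with its orientation. -/
def chordOrigin (e : ι → List (Letter X) × X × List (Letter X)) (a : Letter ι) :
    List (Letter X) :=
  bif a.2 then (e a.1).1 else (e a.1).2.2

/-- The label of a chord, with its orientation. -/
def chordLabel (e : ι → List (Letter X) × X × List (Letter X)) (a : Letter ι) : Letter X :=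
  ((e a.1).2.1, a.2)

/-- The path to the origin of a chord, followed by the chord. -/
def chordStem (e : ι → List (Letter X) × X × List (Letter X)) (a : Letter ι) :
    List (Letter X) :=
  chordOrigin e a ++ [chordLabel e a]

/-- Both orientations of a chord are put in the same form: the path to its origin, the chord, and
the path back from its end, which is the origin of the reversed chord. -/
theorem cond_chordWord (a : Letter ι) :
    (bif a.2 then FreeGroup.mk (chordWord (e a.1)) else (FreeGroup.mk (chordWord (e a.1)))⁻¹) =
      FreeGroup.mk (chordStem e a) * (FreeGroup.mk (chordOrigin e (invLetter a)))⁻¹ := by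
  obtain ⟨i, b⟩ := a
  cases b with
  | true => exact mk_chordWord _
  | false =>
    simp only [cond_false, mk_chordWord, chordStem, chordOrigin, chordLabel, invLetter,
      Bool.not_false, cond_true, ← FreeGroup.mul_mk, mul_inv_rev, inv_inv]
    rw [mul_assoc]
    congr 2

theorem chordOrigin_mem (he : ∀ i, IsTreeChord K Tr (e i)) (a : Letter ι) :
    chordOrigin e a ∈ Tr := by
  obtain ⟨i, b⟩ := a
  cases b
  · exact (he i).snd_mem
  · exact (he i).fst_mem

theorem chordStem_mul_mem (he : ∀ i, IsTreeChord K Tr (e i)) (a : Letter ι) :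
    FreeGroup.mk (chordStem e a) * (FreeGroup.mk (chordOrigin e (invLetter a)))⁻¹ ∈ K := by
  rw [← cond_chordWord]
  have h : FreeGroup.mk (chordWord (e a.1)) ∈ K := by
    rw [mk_chordWord]; exact (he a.1).mem
  cases a.2
  · exact K.inv_mem h
  · exact h

theorem chordStem_ne (he : ∀ i, IsTreeChord K Tr (e i)) (a : Letter ι) :
    chordStem e a ≠ chordOrigin e (invLetter a) := by
  obtain ⟨i, b⟩ := a
  cases b
  · exact (he i).ne_snd
  · exact (he i).ne_fst

theorem chordStem_not_mem (hT : IsCosetTree K Tr) (he : ∀ i, IsTreeChord K Tr (e i))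
    (a : Letter ι) : chordStem e a ∉ Tr := fun h =>
  chordStem_ne he a (hT.eq_of_mem _ h _ (chordOrigin_mem he _) (chordStem_mul_mem he a))

theorem isReduced_chordStem (hT : IsCosetTree K Tr) (he : ∀ i, IsTreeChord K Tr (e i))
    (a : Letter ι) : FreeGroup.IsReduced (chordStem e a) := by
  refine isReduced_concat_iff.mpr ⟨hT.isReduced (chordOrigin_mem he a), fun M hM => ?_⟩
  have hMT : M ∈ Tr := hT.of_concat M _ (hM ▸ chordOrigin_mem he a)
  have hmul := chordStem_mul_mem he a
  have hmk : FreeGroup.mk (chordStem e a) = FreeGroup.mk M := by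
    rw [chordStem, hM, ← FreeGroup.mul_mk, ← FreeGroup.mul_mk, mk_invLetter, inv_mul_cancel_right]
  rw [hmk] at hmul
  have hMeq := hT.eq_of_mem _ hMT _ (chordOrigin_mem he _) hmul
  apply chordStem_ne he (invLetter a)
  rw [invLetter_invLetter, hM, hMeq]
  rfl

theorem chordStem_injective (hT : IsCosetTree K Tr) (he : ∀ i, IsTreeChord K Tr (e i))
    (hinj : Function.Injective e) : Function.Injective (chordStem e) := by
  intro a a' h
  obtain ⟨h₁, h₂⟩ := List.append_inj' h rfl
  have hlab : chordLabel e a = chordLabel e a' := by simpa using h₂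
  have h₃ : chordOrigin e (invLetter a) = chordOrigin e (invLetter a') := by
    refine hT.eq_of_mem _ (chordOrigin_mem he _) _ (chordOrigin_mem he _) ?_
    have := K.mul_mem (K.inv_mem (chordStem_mul_mem he a)) (chordStem_mul_mem he a')
    rwa [h, mul_inv_rev, inv_inv, mul_assoc, inv_mul_cancel_left] at this
  obtain ⟨i, b⟩ := a
  obtain ⟨j, c⟩ := a'
  obtain ⟨hx, hb⟩ := Prod.mk.inj hlab
  simp only at hx hb
  subst hb
  have hij : e i = e j := by
    cases b
    · exact Prod.ext h₃ (Prod.ext hx h₁)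
    · exact Prod.ext h₁ (Prod.ext hx h₃)
  rw [hinj hij]

/-- A proper prefix of a stem lies in the tree and a stem does not, so different stems are
incomparable for the prefix order. -/
theorem chordStem_prefix_unique (hT : IsCosetTree K Tr) (he : ∀ i, IsTreeChord K Tr (e i))
    (hinj : Function.Injective e) {a a' : Letter ι} {G : List (Letter X)}
    (h : chordStem e a <+: G) (h' : chordStem e a' <+: G) : a = a' := by
  have key : ∀ b b' : Letter ι, chordStem e b <+: chordStem e b' → b = b' := by
    intro b b' hbb
    rcases List.prefix_concat_iff.mp hbb with heq | hpre
    · exact chordStem_injective hT he hinj heq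
    · exact absurd (hT.of_prefix hpre (chordOrigin_mem he b')) (chordStem_not_mem hT he b)
  rcases List.prefix_or_prefix_of_prefix h h' with hp | hp
  · exact key _ _ hp
  · exact (key _ _ hp).symm

variable [DecidableEq X]

/-- By induction the product of the remaining factors begins with the stem of `b`. Cancellation
could reach the stem of `a` only if that product began with the stem of `a⁻¹`. Then `b = a⁻¹`, and
the word in the chords would not be reduced. Freeness follows, as stems are nonempty. -/
theorem chordStem_prefix_lift (hT : IsCosetTree K Tr) (he : ∀ i, IsTreeChord K Tr (e i))
    (hinj : Function.Injective e) {a : Letter ι} {L : List (Letter ι)}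
    (hL : FreeGroup.IsReduced (a :: L)) :
    chordStem e a <+:
      (FreeGroup.lift (fun i => FreeGroup.mk (chordWord (e i))) (FreeGroup.mk (a :: L))).toWord := by
  induction L generalizing a with
  | nil =>
    rw [FreeGroup.lift_mk, List.map_cons, List.prod_cons]
    have := cond_chordWord (e := e) a
    rw [this]
    refine prefix_toWord_mul (isReduced_chordStem hT he a)
      (isReduced_chordStem hT he (invLetter a)) ?_
    simp
  | cons b L ih =>
    have hb := ih (a := b) (hL.infix ⟨[a], [], by simp⟩)
    rw [FreeGroup.lift_mk] at hb ⊢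
    rw [List.map_cons, List.prod_cons]
    have := cond_chordWord (e := e) a
    rw [this]
    refine prefix_toWord_mul (isReduced_chordStem hT he a)
      (isReduced_chordStem hT he (invLetter a)) fun hpre => ?_
    have hab := chordStem_prefix_unique hT he hinj hb hpre
    exact isReduced_pair_iff.mp (hL.infix ⟨[], L, by simp⟩ : FreeGroup.IsReduced [a, b]) hab

theorem injective_lift_chordWord (hT : IsCosetTree K Tr) (he : ∀ i, IsTreeChord K Tr (e i))
    (hinj : Function.Injective e) :
    Function.Injective (FreeGroup.lift fun i => FreeGroup.mk (chordWord (e i))) := by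
  classical
  rw [injective_iff_map_eq_one]
  intro g hg
  rw [← FreeGroup.toWord_eq_nil_iff]
  cases hL : g.toWord with
  | nil => rfl
  | cons a L =>
    have hred : FreeGroup.IsReduced (a :: L) := hL ▸ FreeGroup.isReduced_toWord
    have := chordStem_prefix_lift hT he hinj hred
    rw [← hL, FreeGroup.mk_toWord, hg, FreeGroup.toWord_one, List.prefix_nil] at this
    simp [chordStem] at this

/-- Schreier rewriting: along `w`, a step `a` from the coset of `t` to that of `t'` contributes `t a
t'⁻¹`, which is trivial, a chord generator or the inverse of one. Only cosets visited by `w` have to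
be represented, so a finite tree can serve a subgroup of infinite index. -/
theorem mem_closure_chordWord (hT : IsCosetTree K Tr)
    (he : ∀ d, IsTreeChord K Tr d → ∃ i, e i = d) {w : FreeGroup X} (hw : w ∈ K)
    (hcov : ∀ M, M <+: w.toWord → ∃ t ∈ Tr, FreeGroup.mk M * (FreeGroup.mk t)⁻¹ ∈ K) :
    w ∈ Subgroup.closure (Set.range fun i => FreeGroup.mk (chordWord (e i))) := by
  set C := Subgroup.closure (Set.range fun i => FreeGroup.mk (chordWord (e i))) with hC
  have hedge : ∀ t ∈ Tr, ∀ x, ∀ t' ∈ Tr,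
      FreeGroup.mk (t ++ [(x, true)]) * (FreeGroup.mk t')⁻¹ ∈ K →
      FreeGroup.mk (t ++ [(x, true)]) * (FreeGroup.mk t')⁻¹ ∈ C := by
    intro t ht x t' ht' hK
    by_cases h₁ : t ++ [(x, true)] = t'
    · rw [h₁, mul_inv_cancel]; exact C.one_mem
    by_cases h₂ : t' ++ [(x, false)] = t
    · have : FreeGroup.mk (t ++ [(x, true)]) = FreeGroup.mk t' := by
        have hx := mk_invLetter ((x, true) : Letter X)
        rw [← h₂, ← FreeGroup.mul_mk, ← FreeGroup.mul_mk,
          show FreeGroup.mk [(x, false)] = (FreeGroup.mk [(x, true)])⁻¹ from hx,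
          inv_mul_cancel_right]
      rw [this, mul_inv_cancel]; exact C.one_mem
    obtain ⟨i, hi⟩ := he (t, x, t') ⟨ht, ht', hK, h₁, h₂⟩
    rw [← mk_chordWord (t, x, t'), ← hi]
    exact Subgroup.subset_closure ⟨i, rfl⟩
  have key : ∀ M, M <+: w.toWord → ∀ t ∈ Tr, FreeGroup.mk M * (FreeGroup.mk t)⁻¹ ∈ K →
      FreeGroup.mk M * (FreeGroup.mk t)⁻¹ ∈ C := by
    intro M
    induction M using List.reverseRecOn with
    | nil =>
      intro _ t ht hK
      rw [hT.eq_of_mem _ hT.nil_mem _ ht hK, mul_inv_cancel]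
      exact C.one_mem
    | append_singleton M a ih =>
      intro hM t' ht' hK
      have hM' : M <+: w.toWord := (List.prefix_append M [a]).trans hM
      obtain ⟨t, ht, htK⟩ := hcov M hM'
      have hC₁ := ih hM' t ht htK
      have hK₁ : FreeGroup.mk (t ++ [a]) * (FreeGroup.mk t')⁻¹ ∈ K := by
        have := K.mul_mem (K.inv_mem htK) hK
        rwa [← FreeGroup.mul_mk, mul_inv_rev, inv_inv, mul_assoc, mul_assoc (FreeGroup.mk M),
          inv_mul_cancel_left, ← mul_assoc, FreeGroup.mul_mk] at this
      have hC₂ : FreeGroup.mk (t ++ [a]) * (FreeGroup.mk t')⁻¹ ∈ C := by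
        obtain ⟨x, b⟩ := a
        cases b with
        | true => exact hedge t ht x t' ht' hK₁
        | false =>
          have hx : FreeGroup.mk [(x, false)] = (FreeGroup.mk [((x, true) : Letter X)])⁻¹ :=
            mk_invLetter (x, true)
          -- Chords are recorded with positive labels only, so an arc with a negative label is read
          -- backwards.
          have hinv : (FreeGroup.mk (t ++ [(x, false)]) * (FreeGroup.mk t')⁻¹)⁻¹ =
              FreeGroup.mk (t' ++ [(x, true)]) * (FreeGroup.mk t)⁻¹ := by
            rw [← FreeGroup.mul_mk, ← FreeGroup.mul_mk, hx]; group
          rw [← C.inv_mem_iff, hinv]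
          rw [← K.inv_mem_iff, hinv] at hK₁
          exact hedge t' ht' x t ht hK₁
      have := C.mul_mem hC₁ hC₂
      rwa [← FreeGroup.mul_mk, ← mul_assoc, ← mul_assoc, inv_mul_cancel_right, FreeGroup.mul_mk]
        at this
  have hfin := key w.toWord List.prefix_rfl [] hT.nil_mem
    (by rw [FreeGroup.mk_toWord, ← FreeGroup.one_eq_mk, inv_one, mul_one]; exact hw)
  rwa [FreeGroup.mk_toWord, ← FreeGroup.one_eq_mk, inv_one, mul_one] at hfin

/-- The chords of a coset tree that covers all reduced walks of `K` form a free basis of `K`. -/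
theorem isFreeBasisOf_chordWord (hT : IsCosetTree K Tr) (he : ∀ i, IsTreeChord K Tr (e i))
    (hinj : Function.Injective e) (hsurj : ∀ d, IsTreeChord K Tr d → ∃ i, e i = d)
    (hcov : ∀ w ∈ K, ∀ M, M <+: w.toWord → ∃ t ∈ Tr, FreeGroup.mk M * (FreeGroup.mk t)⁻¹ ∈ K) :
    IsFreeBasisOf (fun i => FreeGroup.mk (chordWord (e i))) K := by
  have hrange : (FreeGroup.lift fun i => FreeGroup.mk (chordWord (e i))).range = K := by
    rw [FreeGroup.range_lift_eq_closure]
    apply le_antisymm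
    · rw [Subgroup.closure_le]
      rintro _ ⟨i, rfl⟩
      show FreeGroup.mk (chordWord (e i)) ∈ K
      rw [mk_chordWord]
      exact (he i).mem
    · intro w hw
      exact mem_closure_chordWord hT hsurj hw (hcov w hw)
  refine ⟨⟨((MonoidHom.ofInjective (injective_lift_chordWord hT he hinj)).trans
    (MulEquiv.subgroupCongr hrange)).symm⟩, fun i => ?_⟩
  show ((MulEquiv.subgroupCongr hrange (MonoidHom.ofInjective
    (injective_lift_chordWord hT he hinj) (FreeGroup.of i)) : K) : FreeGroup X) = _
  have hval : ∀ y, ((MulEquiv.subgroupCongr hrange y : K) : FreeGroup X) = y := fun _ => rfl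
  rw [hval]
  exact FreeGroup.lift_apply_of

end Chords

end Trees

/-! ### A free basis of the intersection -/

section Intersection

variable {n : ℕ}

/-- Decides whether `v` and `w` represent the same right coset of `H ∩ H ^ u`. -/
noncomputable def sameInterCoset (S : List (List (Letter (Fin n)))) (u v w : List (Letter (Fin n))) :
    Bool :=
  sameCoset S v w && sameCoset S (u ++ v) (u ++ w)

/-- A prefix-closed list of representatives of the cosets of `H ∩ H ^ u` that contain a word of
length at most `N`. -/
noncomputable def transversal (S : List (List (Letter (Fin n)))) (u : List (Letter (Fin n)))
    (N : ℕ) : List (List (Letter (Fin n))) :=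
  Nat.rec [[]] (fun _ Tr => greedy (sameInterCoset S u) Tr
    (Tr.flatMap fun t => (letters n).map fun a => t ++ [a])) N

/-- All triples of two words of `Tr` and a generator. -/
def arcTriples (Tr : List (List (Letter (Fin n)))) :
    List (List (Letter (Fin n)) × Fin n × List (Letter (Fin n))) :=
  Tr.product ((List.finRange n).product Tr)

/-- Decides whether a triple describes a chord. -/
noncomputable def isChord (S : List (List (Letter (Fin n)))) (u : List (Letter (Fin n)))
    (e : List (Letter (Fin n)) × Fin n × List (Letter (Fin n))) : Bool :=
  sameInterCoset S u (e.1 ++ [(e.2.1, true)]) e.2.2 &&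
    (!(e.1 ++ [(e.2.1, true)] == e.2.2) && !(e.2.2 ++ [(e.2.1, false)] == e.1))

/-- The chords of the computed transversal. -/
noncomputable def interChords (S : List (List (Letter (Fin n)))) (u : List (Letter (Fin n))) :
    List (List (Letter (Fin n)) × Fin n × List (Letter (Fin n))) :=
  (arcTriples (transversal S u ((prefixList S u).length ^ 2))).filter (isChord S u)

/-- The computed free basis of `H ∩ H ^ u`. -/
noncomputable def interBasis (S : List (List (Letter (Fin n)))) (u : List (Letter (Fin n))) :
    List (List (Letter (Fin n))) :=
  (interChords S u).map chordWord

variable {S : List (List (Letter (Fin n)))} {u v w : List (Letter (Fin n))}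

/-- `H ∩ H^u` is the stabilizer of the pair `(H, Hu)`, so its cosets are told apart by the images
`(Hv, Huv)` of this pair. -/
theorem sameInterCoset_iff : sameInterCoset S u v w = true ↔
    FreeGroup.mk v * (FreeGroup.mk w)⁻¹ ∈
      spanWords S ⊓ conjSubgroup (spanWords S) (FreeGroup.mk u) := by
  unfold sameInterCoset
  rw [Bool.and_eq_true, sameCoset_iff, sameCoset_iff, Subgroup.mem_inf, mem_conjSubgroup_iff,
    eq_comm, cosetVertex_eq_iff, eq_comm (a := cosetVertex _ (FreeGroup.mk (u ++ v))),
    cosetVertex_eq_iff, ← FreeGroup.mul_mk, ← FreeGroup.mul_mk, mul_inv_rev, mul_assoc, mul_assoc,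
    mul_assoc]

theorem transversal_succ (N : ℕ) : transversal S u (N + 1) =
    greedy (sameInterCoset S u) (transversal S u N)
      ((transversal S u N).flatMap fun t => (letters n).map fun a => t ++ [a]) := rfl

/-- A candidate extends a listed word by one letter and is added only if its coset is new. This
keeps the list prefix-closed with pairwise different cosets. -/
theorem isCosetTree_and_nodup_transversal (N : ℕ) :
    IsCosetTree (spanWords S ⊓ conjSubgroup (spanWords S) (FreeGroup.mk u))
      {t | t ∈ transversal S u N} ∧ (transversal S u N).Nodup := by
  induction N with
  | zero =>
    refine ⟨⟨List.mem_singleton.mpr rfl, fun t a h => ?_, fun s hs t ht _ => ?_⟩,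
      List.nodup_singleton _⟩
    · exact absurd (List.mem_singleton.mp h) (by simp)
    · exact (List.mem_singleton.mp hs).trans (List.mem_singleton.mp ht).symm
  | succ N ih =>
    rw [transversal_succ]
    refine greedy_induction (P := fun l =>
      IsCosetTree (spanWords S ⊓ conjSubgroup (spanWords S) (FreeGroup.mk u)) {t | t ∈ l} ∧
        l.Nodup) ih ?_
    rintro l w hw hsub ⟨hl, hnd⟩ hnew
    obtain ⟨t, ht, hw⟩ := List.mem_flatMap.mp hw
    obtain ⟨a, -, rfl⟩ := List.mem_map.mp hw
    have hnew' : ∀ v ∈ l, ¬ FreeGroup.mk v * (FreeGroup.mk (t ++ [a]))⁻¹ ∈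
        spanWords S ⊓ conjSubgroup (spanWords S) (FreeGroup.mk u) := fun v hv h => by
      rw [← sameInterCoset_iff, hnew v hv] at h
      exact Bool.false_ne_true h
    refine ⟨⟨List.mem_cons_of_mem _ hl.nil_mem, fun s b hs => ?_, fun s hs s' hs' h => ?_⟩, ?_⟩
    · rcases List.mem_cons.mp hs with hs | hs
      · rw [(List.append_inj' hs rfl).1]
        exact List.mem_cons_of_mem _ (hsub ht)
      · exact List.mem_cons_of_mem _ (hl.of_concat s b hs)
    · rcases List.mem_cons.mp hs with rfl | hs <;> rcases List.mem_cons.mp hs' with rfl | hs'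
      · rfl
      · refine absurd ?_ (hnew' s' hs')
        have := Subgroup.inv_mem _ h
        rwa [mul_inv_rev, inv_inv] at this
      · exact absurd h (hnew' s hs)
      · exact hl.eq_of_mem s hs s' hs' h
    · refine List.nodup_cons.mpr ⟨fun h => hnew' _ h ?_, hnd⟩
      rw [mul_inv_cancel]
      exact Subgroup.one_mem _

theorem exists_mem_transversal {N : ℕ} (hw : w.length ≤ N) : ∃ t ∈ transversal S u N,
    FreeGroup.mk t * (FreeGroup.mk w)⁻¹ ∈
      spanWords S ⊓ conjSubgroup (spanWords S) (FreeGroup.mk u) := by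
  have hnil : ∀ N, ([] : List (Letter (Fin n))) ∈ transversal S u N := fun N =>
    (isCosetTree_and_nodup_transversal N).1.nil_mem
  induction N generalizing w with
  | zero =>
    obtain rfl : w = [] := List.length_eq_zero_iff.mp (Nat.le_zero.mp hw)
    exact ⟨[], hnil 0, by rw [mul_inv_cancel]; exact Subgroup.one_mem _⟩
  | succ N ih =>
    rcases List.eq_nil_or_concat w with rfl | ⟨v, a, rfl⟩
    · exact ⟨[], hnil _, by rw [mul_inv_cancel]; exact Subgroup.one_mem _⟩
    · rw [List.concat_eq_append] at hw ⊢
      obtain ⟨t, ht, htv⟩ := ih (w := v) (by simpa using hw)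
      obtain ⟨s, hs, hst⟩ := exists_mem_greedy (r := sameInterCoset S u)
        (acc := transversal S u N) (w := t ++ [a])
        (L := (transversal S u N).flatMap fun t => (letters n).map fun a => t ++ [a])
        (fun w => sameInterCoset_iff.mpr (by rw [mul_inv_cancel]; exact Subgroup.one_mem _))
        (List.mem_flatMap.mpr ⟨t, ht, List.mem_map.mpr ⟨a, mem_letters a, rfl⟩⟩)
      refine ⟨s, by rw [transversal_succ]; exact hs, ?_⟩
      rw [sameInterCoset_iff] at hst
      have := Subgroup.mul_mem _ hst htv
      rw [← FreeGroup.mul_mk] at this ⊢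
      convert this using 1
      group

/-- The reduced word of `w` labels closed walks at `H` and at `Hu`, both within the traced vertices.
Pigeonhole on pairs of vertices replaces a prefix by a word whose length is at most the square of
the number of prefixes, which explains the depth of the transversal. -/
theorem exists_mem_transversal_of_prefix {w : FreeGroup (Fin n)}
    (hw : w ∈ spanWords S ⊓ conjSubgroup (spanWords S) (FreeGroup.mk u))
    {M : List (Letter (Fin n))} (hM : M <+: w.toWord) :
    ∃ t ∈ transversal S u ((prefixList S u).length ^ 2),
      FreeGroup.mk M * (FreeGroup.mk t)⁻¹ ∈
        spanWords S ⊓ conjSubgroup (spanWords S) (FreeGroup.mk u) := by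
  have h₁ := staysIn_toWord (u := u) base_mem_tracedVerts base_mem_tracedVerts
    (mem_iff_move.mp hw.1)
  have h₂ := staysIn_toWord (S := S) (u := u) target_mem_tracedVerts target_mem_tracedVerts
    (mem_conjSubgroup_iff_move.mp hw.2)
  obtain ⟨L, hLlen, hL⟩ := exists_short_of_staysIn (finite_tracedVerts (S := S) (u := u))
    (fun b : Bool => if b then cosetVertex _ 1 else cosetVertex _ (FreeGroup.mk u)) M
    (fun b => by cases b; exacts [h₂.of_prefix hM, h₁.of_prefix hM])
  obtain ⟨t, ht, htL⟩ := exists_mem_transversal (S := S) (u := u) (w := L)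
    (N := (prefixList S u).length ^ 2)
    (hLlen.trans (by rw [Fintype.card_bool]; exact Nat.pow_le_pow_left ncard_tracedVerts_le _))
  refine ⟨t, ht, ?_⟩
  have hML : FreeGroup.mk M * (FreeGroup.mk L)⁻¹ ∈
      spanWords S ⊓ conjSubgroup (spanWords S) (FreeGroup.mk u) := by
    have hL₁ := hL true
    have hL₂ := hL false
    simp only [if_true, Bool.false_eq_true, if_false, move_cosetVertex, one_mul] at hL₁ hL₂
    rw [cosetVertex_eq_iff] at hL₁ hL₂
    rw [Subgroup.mem_inf, mem_conjSubgroup_iff]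
    refine ⟨hL₁, ?_⟩
    convert hL₂ using 1
    group
  have := Subgroup.mul_mem _ hML (Subgroup.inv_mem _ htL)
  rwa [mul_inv_rev, inv_inv, ← mul_assoc, inv_mul_cancel_right] at this

theorem mem_interChords {e : List (Letter (Fin n)) × Fin n × List (Letter (Fin n))} :
    e ∈ interChords S u ↔
      IsTreeChord (spanWords S ⊓ conjSubgroup (spanWords S) (FreeGroup.mk u))
        {t | t ∈ transversal S u ((prefixList S u).length ^ 2)} e := by
  obtain ⟨t, x, t'⟩ := e
  unfold interChords arcTriples isChord
  rw [List.mem_filter, List.pair_mem_product, List.pair_mem_product]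
  simp only [Bool.and_eq_true, Bool.not_eq_true', beq_eq_false_iff_ne, sameInterCoset_iff]
  constructor
  · rintro ⟨⟨h₁, -, h₂⟩, h₃, h₄, h₅⟩; exact ⟨h₁, h₂, h₃, h₄, h₅⟩
  · rintro ⟨h₁, h₂, h₃, h₄, h₅⟩; exact ⟨⟨h₁, List.mem_finRange _, h₂⟩, h₃, h₄, h₅⟩

theorem nodup_interChords : (interChords S u).Nodup := by
  have h := (isCosetTree_and_nodup_transversal (S := S) (u := u) ((prefixList S u).length ^ 2)).2
  exact (h.product ((List.nodup_finRange n).product h)).filter _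

theorem isFreeBasisOf_interBasis :
    IsFreeBasisOf (fun i : Fin (interBasis S u).length => FreeGroup.mk ((interBasis S u).get i))
      (spanWords S ⊓ conjSubgroup (spanWords S) (FreeGroup.mk u)) := by
  have hlen : (interBasis S u).length = (interChords S u).length := List.length_map _
  let e : Fin (interBasis S u).length → List (Letter (Fin n)) × Fin n × List (Letter (Fin n)) :=
    fun i => (interChords S u).get (i.cast hlen)
  have he : (fun i : Fin (interBasis S u).length => FreeGroup.mk ((interBasis S u).get i)) =
      fun i => FreeGroup.mk (chordWord (e i)) := by
    funext i
    exact congrArg FreeGroup.mk (List.getElem_map chordWord)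
  rw [he]
  refine isFreeBasisOf_chordWord (isCosetTree_and_nodup_transversal _).1
    (fun i => mem_interChords.mp (List.get_mem _ _)) ?_ ?_
    fun w hw M hM => exists_mem_transversal_of_prefix hw hM
  · intro i j hij
    have := (List.nodup_iff_injective_get.mp nodup_interChords) hij
    exact Fin.cast_injective hlen this
  · intro d hd
    obtain ⟨i, hi⟩ := List.get_of_mem (mem_interChords.mpr hd)
    exact ⟨i.cast hlen.symm, hi⟩

/-! ### Primitive recursiveness of the basis computation -/

section

variable {α : Type*} [Primcodable α]

theorem primrec_sameInterCoset {S : α → List (List (Letter (Fin n)))}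
    {u v w : α → List (Letter (Fin n))} (hS : Primrec S) (hu : Primrec u) (hv : Primrec v)
    (hw : Primrec w) : Primrec fun x => sameInterCoset (S x) (u x) (v x) (w x) :=
  Primrec.and.comp (primrec_sameCoset hS hv hw)
    (primrec_sameCoset hS (Primrec.list_append.comp hu hv) (Primrec.list_append.comp hu hw))

theorem primrec_transversal {S : α → List (List (Letter (Fin n)))}
    {u : α → List (Letter (Fin n))} {N : α → ℕ} (hS : Primrec S) (hu : Primrec u)
    (hN : Primrec N) : Primrec fun x => transversal (S x) (u x) (N x) := by
  refine Primrec.nat_rec' (h := fun x p => greedy (sameInterCoset (S x) (u x)) p.2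
    (p.2.flatMap fun t => (letters n).map fun a => t ++ [a])) hN (Primrec.const [[]]) ?_
  refine primrec_greedy (α := α × ℕ × List (List (Letter (Fin n))))
    (r := fun x => sameInterCoset (S x.1) (u x.1))
    (primrec_sameInterCoset (hS.comp (Primrec.fst.comp Primrec.fst))
      (hu.comp (Primrec.fst.comp Primrec.fst)) (Primrec.fst.comp Primrec.snd)
      (Primrec.snd.comp Primrec.snd)) (Primrec.snd.comp Primrec.snd) ?_
  refine Primrec.list_flatMap (Primrec.snd.comp Primrec.snd) ?_
  exact Primrec.list_map (Primrec.const _)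
    (Primrec.list_concat.comp (Primrec.snd.comp Primrec.fst) Primrec.snd)

theorem primrec_list_product {β γ : Type*} [Primcodable β] [Primcodable γ] {f : α → List β}
    {g : α → List γ} (hf : Primrec f) (hg : Primrec g) :
    Primrec fun x => (f x).product (g x) :=
  Primrec.list_flatMap hf (Primrec.list_map (hg.comp Primrec.fst)
    (Primrec.pair (Primrec.snd.comp Primrec.fst) Primrec.snd))

theorem primrec_isChord {S : α → List (List (Letter (Fin n)))}
    {u : α → List (Letter (Fin n))}
    {e : α → List (Letter (Fin n)) × Fin n × List (Letter (Fin n))} (hS : Primrec S)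
    (hu : Primrec u) (he : Primrec e) : Primrec fun x => isChord (S x) (u x) (e x) := by
  have h₁ : Primrec fun x => (e x).1 := Primrec.fst.comp he
  have hx : Primrec fun x => (e x).2.1 := Primrec.fst.comp (Primrec.snd.comp he)
  have h₂ : Primrec fun x => (e x).2.2 := Primrec.snd.comp (Primrec.snd.comp he)
  have hs₁ : Primrec fun x => (e x).1 ++ [((e x).2.1, true)] :=
    Primrec.list_concat.comp h₁ (Primrec.pair hx (Primrec.const true))
  have hs₂ : Primrec fun x => (e x).2.2 ++ [((e x).2.1, false)] :=
    Primrec.list_concat.comp h₂ (Primrec.pair hx (Primrec.const false))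
  have hbeq : Primrec₂ fun v w : List (Letter (Fin n)) => v == w :=
    Primrec.eq.decide.of_eq fun v w => Bool.eq_iff_iff.mpr (by simp)
  exact Primrec.and.comp (primrec_sameInterCoset hS hu hs₁ h₂)
    (Primrec.and.comp (Primrec.not.comp (hbeq.comp hs₁ h₂)) (Primrec.not.comp (hbeq.comp hs₂ h₁)))

theorem primrec_interBasis {S : α → List (List (Letter (Fin n)))}
    {u : α → List (Letter (Fin n))} (hS : Primrec S) (hu : Primrec u) :
    Primrec fun x => interBasis (S x) (u x) := by
  have hT := primrec_transversal hS hu (primrec_natPow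
    (Primrec.list_length.comp (primrec_prefixList.comp hS hu)) (Primrec.const 2))
  refine Primrec.list_map (Primrec.list_filter_param (primrec_list_product hT
    (primrec_list_product (Primrec.const (List.finRange n)) hT))
    (primrec_isChord (hS.comp Primrec.fst) (hu.comp Primrec.fst) Primrec.snd)) ?_
  refine Primrec.list_append.comp (Primrec.list_concat.comp (Primrec.fst.comp Primrec.snd)
    (Primrec.pair (Primrec.fst.comp (Primrec.snd.comp Primrec.snd)) (Primrec.const true))) ?_
  exact primrec_invRev.comp (Primrec.snd.comp (Primrec.snd.comp Primrec.snd))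

end

end Intersection

/-! ### The algorithm -/

section Algorithm

variable {n : ℕ}

/-- The algorithm that computes `F_k(H u)`. -/
noncomputable def preorderAlgorithm
    (x : List (List (Letter (Fin n))) × List (Letter (Fin n)) × ℕ) :
    Option (List (List (Letter (Fin n))) × List (List (Letter (Fin n)))) :=
  bif orbitReps x.1 x.2.1 x.2.2 == [] then none
    else some (orbitReps x.1 x.2.1 x.2.2, interBasis x.1 x.2.1)

theorem computable_preorderAlgorithm : Computable (preorderAlgorithm (n := n)) := by
  have hS : Primrec fun x : List (List (Letter (Fin n))) × List (Letter (Fin n)) × ℕ => x.1 :=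
    Primrec.fst
  have hu : Primrec fun x : List (List (Letter (Fin n))) × List (Letter (Fin n)) × ℕ => x.2.1 :=
    Primrec.fst.comp Primrec.snd
  have hk : Primrec fun x : List (List (Letter (Fin n))) × List (Letter (Fin n)) × ℕ => x.2.2 :=
    Primrec.snd.comp Primrec.snd
  have hreps := primrec_orbitReps hS hu hk
  have hnil : Primrec fun L : List (List (Letter (Fin n))) => L == [] :=
    (Primrec.beq.comp Primrec.list_length (Primrec.const 0)).of_eq fun L => by cases L <;> rfl
  exact (Primrec.cond (hnil.comp hreps) (Primrec.const none)
    (Primrec.option_some.comp (Primrec.pair hreps (primrec_interBasis hS hu)))).to_comp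

theorem computablePred_mem_preorderSet :
    ComputablePred (fun x : List (List (Letter (Fin n))) × List (Letter (Fin n)) × ℕ ×
        List (Letter (Fin n)) =>
      1 ≤ x.2.2.1 ∧ FreeGroup.mk x.2.2.2 ∈
        preorderSet (rCoset (spanWords x.1) (FreeGroup.mk x.2.1)) x.2.2.1) := by
  have hk : Primrec fun x : List (List (Letter (Fin n))) × List (Letter (Fin n)) × ℕ ×
      List (Letter (Fin n)) => x.2.2.1 := Primrec.fst.comp (Primrec.snd.comp Primrec.snd)
  have h := primrec_hasOrder (n := n) (Primrec.fst (β := List (Letter (Fin n)) × ℕ ×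
      List (Letter (Fin n)))) (Primrec.fst.comp Primrec.snd) hk
    (Primrec.snd.comp (Primrec.snd.comp Primrec.snd))
  have h' := Primrec.and.comp (Primrec.nat_le.decide.comp (Primrec.const 1) hk) h
  refine ComputablePred.of_eq (p := fun x : List (List (Letter (Fin n))) ×
    List (Letter (Fin n)) × ℕ × List (Letter (Fin n)) =>
      -- The test for order `k` is correct only for `k ≥ 1`, so this bound is checked as well.
      (decide (1 ≤ x.2.2.1) && hasOrder x.1 x.2.1 x.2.2.1 x.2.2.2) = true) ?_ fun x => ?_
  · exact ComputablePred.computable_iff.mpr ⟨_, h'.to_comp, rfl⟩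
  · rw [Bool.and_eq_true, decide_eq_true_iff]
    exact and_congr_right fun hk => hasOrder_iff hk

theorem preorderAlgorithm_spec (S : List (List (Letter (Fin n)))) (u : List (Letter (Fin n)))
    (k : ℕ) (hk : 1 ≤ k) :
    (preorderAlgorithm (S, u, k) = none →
      preorderSet (rCoset (spanWords S) (FreeGroup.mk u)) k = ∅) ∧
    ∀ ws B : List (List (Letter (Fin n))), preorderAlgorithm (S, u, k) = some (ws, B) →
      (preorderSet (rCoset (spanWords S) (FreeGroup.mk u)) k).Nonempty ∧
      (∀ w ∈ ws, FreeGroup.mk w ∈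
        preorderSet (rCoset (spanWords S) (FreeGroup.mk u)) k) ∧
      IsFreeBasisOf (fun i : Fin B.length => FreeGroup.mk (B.get i))
        (spanWords S ⊓ conjSubgroup (spanWords S) (FreeGroup.mk u)) ∧
      ws.Pairwise (fun w w' => Disjoint (orbitCoset (spanWords S) k (FreeGroup.mk w))
        (orbitCoset (spanWords S) k (FreeGroup.mk w'))) ∧
      preorderSet (rCoset (spanWords S) (FreeGroup.mk u)) k =
        conjSet (⋃ w ∈ ws, orbitCoset (spanWords S) k (FreeGroup.mk w))
          ((spanWords S ⊓ conjSubgroup (spanWords S) (FreeGroup.mk u) :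
            Subgroup (FreeGroup (Fin n))) : Set (FreeGroup (Fin n))) := by
  have hset := preorderSet_eq_conjSet_orbitReps (S := S) (u := u) hk
  have hmem : ∀ w ∈ orbitReps S u k, FreeGroup.mk w ∈
      preorderSet (rCoset (spanWords S) (FreeGroup.mk u)) k := fun w hw =>
    (hasOrder_iff hk).mp (hasOrder_of_mem_orbitReps hw)
  unfold preorderAlgorithm
  cases hnil : orbitReps S u k == [] with
  | true =>
    refine ⟨fun _ => ?_, fun ws B h => by simp at h⟩
    rw [beq_iff_eq] at hnil
    rw [hset, hnil]
    simp [conjSet]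
  | false =>
    refine ⟨fun h => by simp at h, ?_⟩
    intro ws B h
    simp only [cond_false, Option.some.injEq, Prod.mk.injEq] at h
    obtain ⟨rfl, rfl⟩ := h
    refine ⟨?_, hmem, isFreeBasisOf_interBasis, pairwise_orbitReps, hset⟩
    obtain ⟨w, hw⟩ := List.exists_mem_of_ne_nil _ (beq_eq_false_iff_ne.mp hnil)
    exact ⟨_, hmem w hw⟩

end Algorithm

theorem mainTheorem6 (n : ℕ) :
    -- one algorithm, uniform in the generators of `H`, in `u` and in `k`
    (∃ f : List (List (Letter (Fin n))) × List (Letter (Fin n)) × ℕ →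
        Option (List (List (Letter (Fin n))) × List (List (Letter (Fin n)))),
      Computable f ∧
      ∀ (S : List (List (Letter (Fin n)))) (u : List (Letter (Fin n))) (k : ℕ), 1 ≤ k →
        (f (S, u, k) = none →
          preorderSet (rCoset (spanWords S) (FreeGroup.mk u)) k = ∅) ∧
        ∀ ws B : List (List (Letter (Fin n))), f (S, u, k) = some (ws, B) →
          (preorderSet (rCoset (spanWords S) (FreeGroup.mk u)) k).Nonempty ∧
          (∀ w ∈ ws, FreeGroup.mk w ∈
            preorderSet (rCoset (spanWords S) (FreeGroup.mk u)) k) ∧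
          IsFreeBasisOf (fun i : Fin B.length => FreeGroup.mk (B.get i))
            (spanWords S ⊓ conjSubgroup (spanWords S) (FreeGroup.mk u)) ∧
          ws.Pairwise (fun w w' => Disjoint (orbitCoset (spanWords S) k (FreeGroup.mk w))
            (orbitCoset (spanWords S) k (FreeGroup.mk w'))) ∧
          preorderSet (rCoset (spanWords S) (FreeGroup.mk u)) k =
            conjSet (⋃ w ∈ ws, orbitCoset (spanWords S) k (FreeGroup.mk w))
              ((spanWords S ⊓ conjSubgroup (spanWords S) (FreeGroup.mk u) :
                Subgroup (FreeGroup (Fin n))) : Set (FreeGroup (Fin n)))) ∧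
    -- the set of elements of order `k` in `H u` is computable
    ComputablePred (fun x : List (List (Letter (Fin n))) × List (Letter (Fin n)) × ℕ ×
        List (Letter (Fin n)) =>
      1 ≤ x.2.2.1 ∧ FreeGroup.mk x.2.2.2 ∈
        preorderSet (rCoset (spanWords x.1) (FreeGroup.mk x.2.1)) x.2.2.1) ∧
    -- the description through the trails of length `k` in the coset Stallings automaton
    (∀ (H : Subgroup (FreeGroup (Fin n))), H.FG → ∀ (u : FreeGroup (Fin n)) (k : ℕ), 1 ≤ k →
      {q : Fin (k + 1) → RightCosets H | (cosetStallings H u).IsTrail q}.Finite ∧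
      ∀ v v' : (Fin (k + 1) → RightCosets H) → FreeGroup (Fin n),
        (∀ q, (cosetStallings H u).IsTrail q →
          (schreier H).Reads (q 0) (v q) (cosetVertex H 1) ∧
          (schreier H).Reads (q (Fin.last k)) (v' q) (cosetVertex H u)) →
        ((fun q => conjSet ((schreier H).preorbit q)
            (lCoset (v q) H ∩ lCoset (v' q) (conjSubgroup H u))) ''
          {q : Fin (k + 1) → RightCosets H |
            (cosetStallings H u).IsTrail q}).PairwiseDisjoint id ∧
        preorderSet (rCoset H u) k =
          ⋃ q ∈ {q : Fin (k + 1) → RightCosets H | (cosetStallings H u).IsTrail q},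
            conjSet ((schreier H).preorbit q)
              (lCoset (v q) H ∩ lCoset (v' q) (conjSubgroup H u))) ∧
    -- the subgroup case, through the closed trails in the restricted Stallings automaton
    (∀ (H : Subgroup (FreeGroup (Fin n))), H.FG → ∀ k : ℕ, 1 ≤ k →
      {q : Fin (k + 1) → RightCosets H | (restrictedStallings H).IsClosedTrail q}.Finite ∧
      ∀ v : (Fin (k + 1) → RightCosets H) → FreeGroup (Fin n),
        (∀ q, (restrictedStallings H).IsClosedTrail q →
          (schreier H).Reads (q 0) (v q) (cosetVertex H 1)) →
        ((fun q => conjSet ((schreier H).preorbit q) {v q}) ''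
          {q : Fin (k + 1) → RightCosets H |
            (restrictedStallings H).IsClosedTrail q}).PairwiseDisjoint id ∧
        preorderSet (H : Set (FreeGroup (Fin n))) k =
          conjSet
            (⋃ q ∈ {q : Fin (k + 1) → RightCosets H | (restrictedStallings H).IsClosedTrail q},
              conjSet ((schreier H).preorbit q) {v q})
            (H : Set (FreeGroup (Fin n)))) := by
  exact ⟨⟨preorderAlgorithm, computable_preorderAlgorithm, preorderAlgorithm_spec⟩,
    computablePred_mem_preorderSet, fun _ hH u _ hk => trail_description hH u hk,
    fun _ hH _ hk => closedTrail_description hH hk⟩
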